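/- Let $G$ be a group and let $\mathcal P$ be a finite malnormal collection of subgroups of $G$; that is, for all $P,P'\in\mathcal P$ and $g\in G$, either $g^{-1}Pg\cap P'$ is trivial, or $P=P'$ and $g\in P$. Let $\mathcal F$ be the family generated by $\mathcal P$: the set of all subgroups $K\le G$ with $g^{-1}Kg\le P$ for some $g\in G$ and $P\in\mathcal P$. A finite relative presentation $\langle S,\mathcal P\mid \mathcal R\rangle$ of $G$ consists of a finite subset $S\subseteq G$ and a finite set $\mathcal R$ of words over the disjoint union of $S$, formal inverses of $S$, and the groups $P\in\mathcal P$, such that the natural homomorphism $(\ast_{P\in\mathcal P}P)\ast F(S)\to G$ is surjective and its kernel is the normal closure of the elements represented by $\mathcal R$. Its coned-off Cayley complex $X$ is the following $G$-$2$-complex. Start with the undirected Cayley graph of $G$ with respect to $S\cup S^{-1}$ (the edge from $g$ to $gs$ labelled $s$ is identified with the edge from $gs$ to $g$ labelled $s^{-1}$, except that for $s$ of order two the edge from $g$ to $gs$ and the edge from $gs$ to $g$ are kept distinct, so that $G$ acts without inversions). Add a cone-vertex $v(gP)$ for each left coset $gP$ with $g \in G$, $P\in\mathcal P$, and an edge from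 $v(gP)$ to each element of $gP$. Finally, for each $g\in G$ and $r\in\mathcal R$, attach a $2$-cell along the loop at $g$ labelled $r$, where a letter $p\in P$ read at $h \in G$ labels the path $h, v(hP), hp$; the group $G$ acts on the set $G\times\mathcal R$ of $2$-cells by left multiplication on $G$. A $G$-complex is an $F_{2,\mathcal F}$-complex if it has finitely many $G$-orbits of cells, all its isotropy groups belong to $\mathcal F$, and the fixed point set $X^K$ is non-empty and $1$-connected for every $K\in\mathcal F$. (1) For every finite relative presentation $\langle S,\mathcal P\mid\mathcal R\rangle$ of $G$, the induced coned-off Cayley complex $X$ is an $F_{2,\mathcal F}$-complex (provided $\mathcal P\neq\emptyset$), the $G$-stabilizer of every $1$-cell of $X$ is trivial, and for each $K\in\mathcal F$ the fixed point set $X^K$ is either a point or all of $X$. (2) If $G$ is finitely presented and every $P\in\mathcal P$ is finitely generated, then $G$ is of type $FP_{2,\mathcal F}$: over the orbit category $\mathcal O_{\mathcal F}(G)$, the constant right module $\mathbb Z_{G,\mathcal F}=\mathbb Z[\cdot,G/G]$ has a projective resolution $\cdots\to P_2\to P_1\to P_0\to\mathbb Z_{G,\mathcal F}\to 0$ with $P_0,P_1,P_2$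 finitely generated. -/

import Mathlib

universe u

/-! ### Combinatorial 2-complexes, edge paths and simple connectivity -/

/-- `p` is an edge path from `a` to `b`: a list of consecutive oriented edges. -/
def IsEdgePath {V D : Type u} (src tgt : D → V) : V → List D → V → Prop
  | a, [], b => a = b
  | a, d :: p, b => src d = a ∧ IsEdgePath src tgt (tgt d) p b

/-- A combinatorial complex of dimension at most two. `V` is the set of 0-cells, `D` the set of
oriented 1-cells (each 1-cell is a pair `{d, rev d}`), and `C` the set of 2-cells; the 2-cell `c` is
attached along the closed edge path `bdry c`, which starts and ends at `base c`. -/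
structure TwoComplex where
  V : Type u
  D : Type u
  C : Type u
  src : D → V
  rev : D → D
  rev_rev : ∀ d, rev (rev d) = d
  rev_ne : ∀ d, rev d ≠ d
  base : C → V
  bdry : C → List D
  bdry_closed : ∀ c, IsEdgePath src (fun d => src (rev d)) (base c) (bdry c) (base c)

namespace TwoComplex

variable (X : TwoComplex.{u})

/-- The terminal vertex of an oriented edge. -/
def tgt (d : X.D) : X.V := X.src (X.rev d)

/-- Edge paths of `X` from `a` to `b`. -/
def IsPath (a : X.V) (p : List X.D) (b : X.V) : Prop := IsEdgePath X.src X.tgt a p b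

/-- Elementary homotopies: deleting a backtrack, or deleting the boundary of a 2-cell. -/
inductive Step : List X.D → List X.D → Prop
  | backtrack (p : List X.D) (d : X.D) (q : List X.D) : Step (p ++ d :: X.rev d :: q) (p ++ q)
  | face (p : List X.D) (c : X.C) (q : List X.D) : Step (p ++ X.bdry c ++ q) (p ++ q)

/-- Homotopy, relative to the endpoints, of edge paths from `a` to `b`: the equivalence relation
generated by elementary homotopies between such paths. -/
def Homotopic (a b : X.V) : List X.D → List X.D → Prop :=
  Relation.EqvGen fun p q => X.IsPath a p b ∧ X.IsPath a q b ∧ X.Step p q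

/-- `X` is non-empty and 1-connected: it is path connected and its edge-path group is trivial. -/
def SimplyConnected : Prop :=
  Nonempty X.V ∧ (∀ a b : X.V, ∃ p, X.IsPath a p b) ∧
    ∀ (a : X.V) (p : List X.D), X.IsPath a p a → X.Homotopic a a p []

/-- `X` consists of a single 0-cell. -/
def IsPoint : Prop := (∃! _v : X.V, True) ∧ IsEmpty X.D ∧ IsEmpty X.C

end TwoComplex

/-! ### Group actions on 2-complexes -/

/-- A 2-complex with a combinatorial action of `G` without inversions. The boundary paths of the
2-cells are based equivariantly, so an element that fixes a 2-cell setwise fixes its boundary path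
pointwise. -/
structure GTwoComplex (G : Type u) [Group G] extends TwoComplex.{u} where
  [actV : MulAction G V]
  [actD : MulAction G D]
  [actC : MulAction G C]
  smul_src : ∀ (g : G) (d : D), src (g • d) = g • src d
  smul_rev : ∀ (g : G) (d : D), rev (g • d) = g • rev d
  smul_base : ∀ (g : G) (c : C), base (g • c) = g • base c
  smul_bdry : ∀ (g : G) (c : C), bdry (g • c) = (bdry c).map (g • ·)
  no_inversion : ∀ (g : G) (d : D), g • d ≠ rev d

attribute [instance] GTwoComplex.actV GTwoComplex.actD GTwoComplex.actC

namespace GTwoComplex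

variable {G : Type u} [Group G] (X : GTwoComplex G)

/-- The setwise `G`-stabilizer of the 1-cell `{d, rev d}`. -/
def edgeStabilizer (d : X.D) : Subgroup G where
  carrier := {g | g • d = d ∨ g • d = X.rev d}
  mul_mem' := by
    rintro a b (ha | ha) (hb | hb)
    · exact Or.inl (by rw [mul_smul, hb, ha])
    · exact absurd hb (X.no_inversion b d)
    · exact absurd ha (X.no_inversion a d)
    · exact absurd ha (X.no_inversion a d)
  one_mem' := Or.inl (one_smul G d)
  inv_mem' := by
    rintro a (ha | ha)
    · exact Or.inl (inv_smul_eq_iff.mpr ha.symm)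
    · exact absurd ha (X.no_inversion a d)

/-- Cocompactness: there are finitely many orbits of cells. -/
def Cocompact : Prop :=
  Finite (MulAction.orbitRel.Quotient G X.V) ∧ Finite (MulAction.orbitRel.Quotient G X.D) ∧
    Finite (MulAction.orbitRel.Quotient G X.C)

/-- All isotropy groups, i.e. all stabilizers of cells, belong to `F`. -/
def IsotropyIn (F : Set (Subgroup G)) : Prop :=
  (∀ v : X.V, MulAction.stabilizer G v ∈ F) ∧ (∀ d : X.D, X.edgeStabilizer d ∈ F) ∧
    ∀ c : X.C, MulAction.stabilizer G c ∈ F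

theorem mem_bdry_fixed (K : Subgroup G) {c : X.C} (hc : ∀ k ∈ K, k • c = c) :
    ∀ d ∈ X.bdry c, ∀ k ∈ K, k • d = d := by
  intro d hd k hk
  have h : (X.bdry c).map (k • ·) = (X.bdry c).map id := by
    rw [← X.smul_bdry, hc k hk, List.map_id]
  exact List.map_inj_left.mp h d hd

theorem isEdgePath_attachWith {V D : Type u} {src tgt : D → V} {A : V → Prop} {B : D → Prop}
    (hs : ∀ d, B d → A (src d)) (ht : ∀ d, B d → A (tgt d)) :
    ∀ (l : List D) (hl : ∀ d ∈ l, B d) (a b : V) (ha : A a) (hb : A b), IsEdgePath src tgt a l b →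
      IsEdgePath (fun d : {d // B d} => (⟨src d.1, hs d.1 d.2⟩ : {v // A v}))
        (fun d : {d // B d} => (⟨tgt d.1, ht d.1 d.2⟩ : {v // A v})) ⟨a, ha⟩ (l.attachWith B hl)
        ⟨b, hb⟩
  | [], _, _, _, _, _, h => Subtype.ext h
  | d :: l, hl, _, b, _, hb, h =>
    ⟨Subtype.ext h.1, isEdgePath_attachWith hs ht l (fun x hx => hl x (List.mem_cons_of_mem d hx))
      (tgt d) b (ht d (hl d List.mem_cons_self)) hb h.2⟩

/-- The fixed point set `X^K`, the subcomplex of all cells fixed by `K`. -/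
def fixed (K : Subgroup G) : TwoComplex.{u} where
  V := {v : X.V // ∀ k ∈ K, k • v = v}
  D := {d : X.D // ∀ k ∈ K, k • d = d}
  C := {c : X.C // ∀ k ∈ K, k • c = c}
  src d := ⟨X.src d.1, fun k hk => by rw [← X.smul_src, d.2 k hk]⟩
  rev d := ⟨X.rev d.1, fun k hk => by rw [← X.smul_rev, d.2 k hk]⟩
  rev_rev d := Subtype.ext (X.rev_rev d.1)
  rev_ne d h := X.rev_ne d.1 (congrArg Subtype.val h)
  base c := ⟨X.base c.1, fun k hk => by rw [← X.smul_base, c.2 k hk]⟩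
  bdry c := (X.bdry c.1).attachWith _ (X.mem_bdry_fixed K c.2)
  bdry_closed c := isEdgePath_attachWith (src := X.src) (tgt := fun d => X.src (X.rev d))
    (A := fun v => ∀ k ∈ K, k • v = v) (B := fun d => ∀ k ∈ K, k • d = d)
    (fun d hd k hk => by rw [← X.smul_src, hd k hk])
    (fun d hd k hk => by rw [← X.smul_src, ← X.smul_rev, hd k hk])
    _ _ _ _ _ _ (X.bdry_closed c.1)

/-- `X^K = X`: the subgroup `K` fixes every cell. -/
def FixesAll (K : Subgroup G) : Prop :=
  (∀ k ∈ K, ∀ v : X.V, k • v = v) ∧ (∀ k ∈ K, ∀ d : X.D, k • d = d) ∧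
    ∀ k ∈ K, ∀ c : X.C, k • c = c

/-- `X` is an `F_{2,F}`-complex for `G`. -/
structure IsF2Complex (F : Set (Subgroup G)) : Prop where
  cocompact : X.Cocompact
  isotropy : X.IsotropyIn F
  fixed_simplyConnected : ∀ K ∈ F, (X.fixed K).SimplyConnected

end GTwoComplex

/-! ### Collections of subgroups -/

section Collections

variable {G : Type u} [Group G]

/-- A malnormal collection: for `P, P'` in the collection and `g ∈ G`, either `g⁻¹ P g ∩ P'` is
trivial, or `P = P'` and `g ∈ P`. -/
def IsMalnormalCollection (𝓟 : Set (Subgroup G)) : Prop :=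
  ∀ P ∈ 𝓟, ∀ P' ∈ 𝓟, ∀ g : G, (∀ x ∈ P, g⁻¹ * x * g ∈ P' → g⁻¹ * x * g = 1) ∨ (P = P' ∧ g ∈ P)

/-- The family generated by `𝓟`: all `K` with `g⁻¹ K g ≤ P` for some `g ∈ G` and `P ∈ 𝓟`. -/
def generatedFamily (𝓟 : Set (Subgroup G)) : Set (Subgroup G) :=
  {K | ∃ g : G, ∃ P ∈ 𝓟, ∀ k ∈ K, g⁻¹ * k * g ∈ P}

/-! ### Relative presentations -/

/-- The free product `(∗_{P ∈ 𝓟} P) ∗ F(S)`. -/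
abbrev RelFree (𝓟 : Set (Subgroup G)) (S : Set G) : Type u :=
  Monoid.Coprod (Monoid.CoprodI fun P : 𝓟 => P.1) (FreeGroup S)

/-- The natural homomorphism `(∗_{P ∈ 𝓟} P) ∗ F(S) → G`. -/
def relFreeHom (𝓟 : Set (Subgroup G)) (S : Set G) : RelFree 𝓟 S →* G :=
  Monoid.Coprod.lift (Monoid.CoprodI.lift fun P : 𝓟 => P.1.subtype)
    (FreeGroup.lift (Subtype.val : S → G))

/-- Letters of words over the disjoint union of `S` and all `P ∈ 𝓟`: `gen s true` is
`s`, `gen s false` is the formal inverse of `s`, and `per P p` is the element `p` of `P`. -/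
inductive RelLetter (𝓟 : Set (Subgroup G)) (S : Set G) : Type u
  | gen (s : S) (ε : Bool)
  | per (P : 𝓟) (p : P.1)

namespace RelLetter

variable {𝓟 : Set (Subgroup G)} {S : Set G}

/-- The element of the free product represented by a letter. -/
def toFree : RelLetter 𝓟 S → RelFree 𝓟 S
  | gen s true => Monoid.Coprod.inr (FreeGroup.of s)
  | gen s false => (Monoid.Coprod.inr (FreeGroup.of s))⁻¹
  | per P p => Monoid.Coprod.inl (Monoid.CoprodI.of (i := P) p)

/-- The element of `G` represented by a letter. -/
def val : RelLetter 𝓟 S → G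
  | gen s true => s.1
  | gen s false => s.1⁻¹
  | per _ p => p.1

theorem relFreeHom_toFree (x : RelLetter 𝓟 S) : relFreeHom 𝓟 S x.toFree = x.val := by
  rcases x with ⟨s, _ | _⟩ | ⟨P, p⟩ <;> simp [toFree, val, relFreeHom]

end RelLetter

/-- The element of the free product represented by a word. -/
def relWordToFree {𝓟 : Set (Subgroup G)} {S : Set G} (w : List (RelLetter 𝓟 S)) : RelFree 𝓟 S :=
  (w.map RelLetter.toFree).prod

/-- A finite relative presentation `⟨S, 𝓟 ∣ R⟩` of `G`. -/
structure FiniteRelPresentation (𝓟 : Set (Subgroup G)) where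
  S : Set G
  finite_S : S.Finite
  R : Set (List (RelLetter 𝓟 S))
  finite_R : R.Finite
  surjective : Function.Surjective (relFreeHom 𝓟 S)
  ker_eq : (relFreeHom 𝓟 S).ker = Subgroup.normalClosure (relWordToFree '' R)

/-! ### The coned-off Cayley complex -/

/-- Labels of the oriented edges of the Cayley graph with respect to `S ∪ S⁻¹`. There is one label
for each element `x ∈ S ∪ S⁻¹` with `x² ≠ 1`. If `x² = 1` there are two labels `(x, true)` and
`(x, false)`, which are inverse to each other: for `x = 1` they are the two orientations of a loop,
and for `x` of order two they keep the edge from `g` to `gx` apart from the edge from `gx` to `g`,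
so that `G` acts without inversions. -/
def CayleyLabel (S : Set G) : Type u :=
  {x : G × Bool // (x.1 ∈ S ∨ x.1⁻¹ ∈ S) ∧ (x.1 * x.1 ≠ 1 → x.2 = true)}

namespace CayleyLabel

variable {S : Set G}

open Classical in
/-- The label of the same edge with the opposite orientation. -/
noncomputable def inv (x : CayleyLabel S) : CayleyLabel S :=
  ⟨(x.1.1⁻¹, if x.1.1 * x.1.1 = 1 then !x.1.2 else true), by
    refine ⟨?_, ?_⟩
    · rw [inv_inv]
      exact x.2.1.symm
    · intro h
      have h' : x.1.1 * x.1.1 ≠ 1 := fun e => h (by rw [← mul_inv_rev, e, inv_one])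
      simp [h']⟩

theorem inv_fst (x : CayleyLabel S) : x.inv.1.1 = x.1.1⁻¹ := rfl

theorem inv_inv (x : CayleyLabel S) : x.inv.inv = x := by
  obtain ⟨⟨x, b⟩, hx⟩ := x
  have e : x⁻¹ * x⁻¹ = 1 ↔ x * x = 1 := by rw [← mul_inv_rev, inv_eq_one]
  by_cases h : x * x = 1
  · exact Subtype.ext (by simp [inv, h, e])
  · have hb : b = true := hx.2 h
    exact Subtype.ext (by simp [inv, h, e, hb])

theorem inv_ne (x : CayleyLabel S) : x.inv ≠ x := by
  obtain ⟨⟨x, b⟩, hx⟩ := x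
  intro h
  have h1 : x⁻¹ = x := congrArg (fun y => y.1.1) h
  have h2 : x * x = 1 := by
    nth_rewrite 1 [← h1]
    exact inv_mul_cancel x
  have h3 := congrArg (fun y => y.1.2) h
  simp [inv, h2] at h3

/-- The label of a generator `s` (`ε = true`) or of its formal inverse (`ε = false`). -/
noncomputable def ofGen (s : S) : Bool → CayleyLabel S
  | true => ⟨(s.1, true), Or.inl s.2, fun _ => rfl⟩
  | false => inv ⟨(s.1, true), Or.inl s.2, fun _ => rfl⟩

end CayleyLabel

/-- Vertices of the coned-off Cayley graph: the elements of `G`, and a cone-vertex for each left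
coset `gP` with `P ∈ 𝓟`. -/
inductive ConedVertex (𝓟 : Set (Subgroup G)) : Type u
  | elem (g : G)
  | cone (P : 𝓟) (x : G ⧸ P.1)

/-- Oriented edges of the coned-off Cayley graph. `cayley g x` goes from `g` to `gx`; `cone P g true`
goes from the cone-vertex `v(gP)` to `g`, and `cone P g false` from `g` to `v(gP)`. -/
inductive ConedDart (𝓟 : Set (Subgroup G)) (S : Set G) : Type u
  | cayley (g : G) (x : CayleyLabel S)
  | cone (P : 𝓟) (g : G) (b : Bool)

section Graph

variable {𝓟 : Set (Subgroup G)} {S : Set G}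

instance : MulAction G (ConedVertex 𝓟) where
  smul h v := match v with
    | .elem g => .elem (h * g)
    | .cone P x => .cone P (h • x)
  one_smul v := by
    rcases v with g | ⟨P, x⟩
    · exact congrArg ConedVertex.elem (one_mul g)
    · exact congrArg (ConedVertex.cone P) (one_smul G x)
  mul_smul a b v := by
    rcases v with g | ⟨P, x⟩
    · exact congrArg ConedVertex.elem (mul_assoc a b g)
    · exact congrArg (ConedVertex.cone P) (mul_smul a b x)

instance : MulAction G (ConedDart 𝓟 S) where
  smul h d := match d with
    | .cayley g x => .cayley (h * g) x
    | .cone P g b => .cone P (h * g) b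
  one_smul d := by
    rcases d with ⟨g, x⟩ | ⟨P, g, b⟩
    · exact congrArg (ConedDart.cayley · x) (one_mul g)
    · exact congrArg (ConedDart.cone P · b) (one_mul g)
  mul_smul a c d := by
    rcases d with ⟨g, x⟩ | ⟨P, g, b⟩
    · exact congrArg (ConedDart.cayley · x) (mul_assoc a c g)
    · exact congrArg (ConedDart.cone P · b) (mul_assoc a c g)

namespace ConedDart

/-- The initial vertex of an oriented edge. -/
def src : ConedDart 𝓟 S → ConedVertex 𝓟
  | cayley g _ => .elem g
  | cone P g true => .cone P (QuotientGroup.mk g)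
  | cone _ g false => .elem g

/-- The oppositely oriented edge. -/
noncomputable def rev : ConedDart 𝓟 S → ConedDart 𝓟 S
  | cayley g x => cayley (g * x.1.1) x.inv
  | cone P g b => cone P g (!b)

theorem rev_rev (d : ConedDart 𝓟 S) : d.rev.rev = d := by
  rcases d with ⟨g, x⟩ | ⟨P, g, b⟩
  · simp [rev, CayleyLabel.inv_inv, CayleyLabel.inv_fst]
  · simp [rev]

theorem smul_src (h : G) (d : ConedDart 𝓟 S) : (h • d).src = h • d.src := by
  rcases d with ⟨g, x⟩ | ⟨P, g, _ | _⟩ <;> rfl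

theorem smul_rev (h : G) (d : ConedDart 𝓟 S) : (h • d).rev = h • d.rev := by
  rcases d with ⟨g, x⟩ | ⟨P, g, b⟩
  · exact congrArg (ConedDart.cayley · x.inv) (mul_assoc h g x.1.1)
  · rfl

theorem no_inversion (h : G) (d : ConedDart 𝓟 S) : h • d ≠ d.rev := by
  rcases d with ⟨g, x⟩ | ⟨P, g, b⟩
  · intro e
    exact x.inv_ne (ConedDart.cayley.inj e).2.symm
  · intro e
    have := (ConedDart.cone.inj e).2.2
    simp at this

end ConedDart

/-- The edge path from `g` to `g * x.val` with label the letter `x`: a single edge of the Cayley graph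
for a letter in `S ∪ S⁻¹`, and the path of length two `g, v(gP), gp` for a letter `p ∈ P`. -/
noncomputable def letterPath (g : G) : RelLetter 𝓟 S → List (ConedDart 𝓟 S)
  | .gen s ε => [.cayley g (CayleyLabel.ofGen s ε)]
  | .per P p => [.cone P g false, .cone P (g * p.1) true]

/-- The edge path with initial vertex `g` and label the word `w`. -/
noncomputable def wordPath : G → List (RelLetter 𝓟 S) → List (ConedDart 𝓟 S)
  | _, [] => []
  | g, x :: w => letterPath g x ++ wordPath (g * x.val) w

theorem smul_letterPath (h g : G) (x : RelLetter 𝓟 S) :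
    letterPath (h * g) x = (letterPath g x).map (h • ·) := by
  rcases x with ⟨s, ε⟩ | ⟨P, p⟩
  · rfl
  · simp only [letterPath, mul_assoc]
    rfl

theorem smul_wordPath (h : G) : ∀ (w : List (RelLetter 𝓟 S)) (g : G),
    wordPath (h * g) w = (wordPath g w).map (h • ·)
  | [], _ => rfl
  | x :: w, g => by
    rw [wordPath, wordPath, List.map_append, smul_letterPath, mul_assoc, smul_wordPath h w]

theorem isEdgePath_wordPath : ∀ (w : List (RelLetter 𝓟 S)) (g : G),
    IsEdgePath ConedDart.src (fun d => d.rev.src) (.elem g) (wordPath g w)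
      (.elem (g * (w.map RelLetter.val).prod))
  | [], g => by simp [wordPath, IsEdgePath]
  | .gen s ε :: w, g => by
    have ih := isEdgePath_wordPath w (g * (RelLetter.gen (𝓟 := 𝓟) s ε).val)
    have hv : (CayleyLabel.ofGen s ε).1.1 = (RelLetter.gen (𝓟 := 𝓟) s ε).val := by
      cases ε <;> rfl
    refine ⟨rfl, ?_⟩
    simp only [ConedDart.rev, ConedDart.src, hv, List.map_cons, List.prod_cons, ← mul_assoc]
    exact ih
  | .per P p :: w, g => by
    have ih := isEdgePath_wordPath w (g * (RelLetter.per (S := S) P p).val)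
    have hc : (QuotientGroup.mk (g * p.1) : G ⧸ P.1) = QuotientGroup.mk g :=
      QuotientGroup.mk_mul_of_mem g p.2
    refine ⟨rfl, congrArg (ConedVertex.cone P) hc, ?_⟩
    simp only [List.map_cons, List.prod_cons, ← mul_assoc]
    exact ih

end Graph

namespace FiniteRelPresentation

variable {𝓟 : Set (Subgroup G)} (pres : FiniteRelPresentation 𝓟)

theorem relator_val (r : pres.R) : (r.1.map RelLetter.val).prod = 1 := by
  have h : relWordToFree r.1 ∈ (relFreeHom 𝓟 pres.S).ker := by
    rw [pres.ker_eq]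
    exact Subgroup.subset_normalClosure ⟨r.1, r.2, rfl⟩
  rw [MonoidHom.mem_ker, relWordToFree, map_list_prod, List.map_map] at h
  rw [← h]
  congr 1
  exact List.map_congr_left fun x _ => (RelLetter.relFreeHom_toFree x).symm

/-- The action of `G` on the set `G × R` of 2-cells; it is free. -/
instance : MulAction G (G × pres.R) where
  smul h c := (h * c.1, c.2)
  one_smul c := Prod.ext (one_mul c.1) rfl
  mul_smul a b c := Prod.ext (mul_assoc a b c.1) rfl

/-- The coned-off Cayley complex induced by a finite relative presentation: the coned-off Cayley
graph with, for each `g ∈ G` and each relator `r`, a 2-cell attached along the loop at `g` labelled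
`r`. -/
noncomputable def conedOffCayleyComplex : GTwoComplex G where
  V := ConedVertex 𝓟
  D := ConedDart 𝓟 pres.S
  C := G × pres.R
  src := ConedDart.src
  rev := ConedDart.rev
  rev_rev := ConedDart.rev_rev
  rev_ne d h := ConedDart.no_inversion 1 d (by rw [one_smul, h])
  base c := .elem c.1
  bdry c := wordPath c.1 c.2.1
  bdry_closed c := by
    have h := isEdgePath_wordPath c.2.1 c.1
    rwa [pres.relator_val, mul_one] at h
  smul_src := ConedDart.smul_src
  smul_rev := ConedDart.smul_rev
  smul_base _ _ := rfl
  smul_bdry h c := smul_wordPath h c.2.1 c.1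
  no_inversion := ConedDart.no_inversion

end FiniteRelPresentation

end Collections

/-! ### Modules over the orbit category -/

section Bredon

open CategoryTheory

variable {G : Type u} [Group G]

/-- Objects of the orbit category `O_F(G)`: the `G`-sets `G/H` with `H ∈ F`. -/
structure OrbitCat (F : Set (Subgroup G)) : Type u where
  H : Subgroup G
  mem : H ∈ F

/-- The morphisms of the orbit category are the `G`-maps `G/H → G/K`. -/
instance (F : Set (Subgroup G)) : Category.{u} (OrbitCat F) where
  Hom A B := (G ⧸ A.H) →[G] (G ⧸ B.H)
  id A := MulActionHom.id G
  comp f g := g.comp f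

/-- Right `O_F(G)`-modules: contravariant functors to abelian groups. -/
abbrev OrbitModule (F : Set (Subgroup G)) : Type (u + 1) := (OrbitCat F)ᵒᵖ ⥤ ModuleCat.{u} ℤ

/-- The fixed point set `T^H` of a `G`-set `T`. -/
def FixedPts (T : Type u) [MulAction G T] (H : Subgroup G) : Type u :=
  {t : T // ∀ h ∈ H, h • t = t}

/-- For `t ∈ T^K`, the map `G/K → T` that sends `gK` to `g • t`. -/
def cosetSMul {T : Type u} [MulAction G T] {K : Subgroup G} (x : G ⧸ K) (t : FixedPts T K) : T :=
  Quotient.liftOn' x (fun g => g • t.1) fun a b hab => by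
    have h := t.2 _ (QuotientGroup.leftRel_apply.mp hab)
    change a • t.1 = b • t.1
    conv_lhs => rw [← h]
    rw [← mul_smul, mul_inv_cancel_left]

theorem cosetSMul_mk {T : Type u} [MulAction G T] {K : Subgroup G} (g : G) (t : FixedPts T K) :
    cosetSMul (QuotientGroup.mk g : G ⧸ K) t = g • t.1 := rfl

theorem cosetSMul_smul {T : Type u} [MulAction G T] {K : Subgroup G} (g : G) (x : G ⧸ K)
    (t : FixedPts T K) : cosetSMul (g • x) t = g • cosetSMul x t := by
  induction x using QuotientGroup.induction_on with
  | H a => exact mul_smul g a t.1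

/-- The map `T^K → T^H`, `t ↦ g • t`, induced by a `G`-map `φ : G/H → G/K` with `φ(H) = gK`. -/
def fixedPtsMap (T : Type u) [MulAction G T] {H K : Subgroup G} (φ : (G ⧸ H) →[G] (G ⧸ K))
    (t : FixedPts T K) : FixedPts T H :=
  ⟨cosetSMul (φ (QuotientGroup.mk 1)) t, fun h hh => by
    rw [← cosetSMul_smul, ← map_smul]
    congr 2
    change (QuotientGroup.mk (h * 1) : G ⧸ H) = QuotientGroup.mk 1
    rw [QuotientGroup.eq]
    simpa using hh⟩

theorem cosetSMul_comp (T : Type u) [MulAction G T] {H K L : Subgroup G}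
    (φ : (G ⧸ H) →[G] (G ⧸ K)) (ψ : (G ⧸ K) →[G] (G ⧸ L)) (t : FixedPts T L) :
    cosetSMul (ψ (φ (QuotientGroup.mk 1))) t =
      cosetSMul (φ (QuotientGroup.mk 1)) (fixedPtsMap T ψ t) := by
  induction φ (QuotientGroup.mk 1) using QuotientGroup.induction_on with
  | H a =>
    have h : (QuotientGroup.mk a : G ⧸ K) = a • (QuotientGroup.mk 1 : G ⧸ K) :=
      congrArg QuotientGroup.mk (mul_one a).symm
    rw [cosetSMul_mk, h, map_smul, cosetSMul_smul]
    rfl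

/-- The contravariant functor `G/H ↦ T^H` of a `G`-set `T`. -/
def fixedPtsFunctor (F : Set (Subgroup G)) (T : Type u) [MulAction G T] :
    (OrbitCat F)ᵒᵖ ⥤ Type u where
  obj A := FixedPts T A.unop.H
  map f := TypeCat.ofHom (fixedPtsMap T f.unop)
  map_id A := by
    ext t
    exact Subtype.ext (one_smul G t.1)
  map_comp f g := by
    ext t
    exact Subtype.ext (cosetSMul_comp T g.unop f.unop t)

/-- The free abelian group functor `Y ↦ ℤ[Y]`. -/
noncomputable def freeAb : Type u ⥤ ModuleCat.{u} ℤ where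
  obj Y := ModuleCat.of ℤ (Y →₀ ℤ)
  map f := ModuleCat.ofHom (Finsupp.lmapDomain ℤ ℤ (f : _ → _))
  map_id Y := by
    ext : 1
    exact Finsupp.lmapDomain_id ℤ ℤ
  map_comp f g := by
    ext : 1
    exact Finsupp.lmapDomain_comp ℤ ℤ f g

/-- The module `ℤ[·, T]` induced by a `G`-set `T`. -/
noncomputable def inducedModule (F : Set (Subgroup G)) (T : Type u) [MulAction G T] :
    OrbitModule F :=
  fixedPtsFunctor F T ⋙ freeAb

/-- The module `ℤ_{G,F} = ℤ[·, G/G]`. -/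
noncomputable def trivialOrbitModule (F : Set (Subgroup G)) : OrbitModule F :=
  inducedModule F (G ⧸ (⊤ : Subgroup G))

/-- A module is finitely generated if it is a quotient of a finitely generated free module, i.e. of
some `ℤ[·, T]` where `T` is a `G`-set with isotropy groups in `F` and finitely many orbits. -/
def OrbitModuleFG {F : Set (Subgroup G)} (M : OrbitModule F) : Prop :=
  ∃ (T : Type u) (_ : MulAction G T), (∀ t : T, MulAction.stabilizer G t ∈ F) ∧
    Finite (MulAction.orbitRel.Quotient G T) ∧ ∃ f : inducedModule F T ⟶ M, Epi f

/-- `G` is of type `FP_{n,F}`: the module `ℤ_{G,F}` has a resolution by projective modules that are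
finitely generated in degrees `0, …, n`. -/
def IsTypeFP (n : ℕ) (F : Set (Subgroup G)) : Prop :=
  ∃ P : ProjectiveResolution (trivialOrbitModule F), ∀ i ≤ n, OrbitModuleFG (P.complex.X i)

end Bredon

/-! ### Edge paths and homotopies -/

/-! Everything rests on two facts. First, `G` acts freely on edges and 2-cells, and malnormality
leaves a non-trivial member of the family with exactly one fixed vertex, a cone-vertex
(`ConedVertex.existsUnique_fixed`). Hence `X^K` is a point for non-trivial `K` and all of `X` for
trivial `K`, and only `X` itself has to be studied.

Second, `X` is 1-connected. Let the free product act on the right on homotopy classes of edge paths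
from a fixed vertex to elements of `G`, by appending the path of a letter. Multiplication in each
`P` is respected because an excursion from a cone-vertex to one of its neighbours is a backtrack.
Relators act trivially because they bound 2-cells, so the kernel of the map to `G` acts trivially. A
loop at `g` is labelled by a word in that kernel; acting on the constant path, the word yields the
class of the loop, which is therefore trivial (`homotopic_nil_of_elem`).

For finiteness over the orbit category, a finite presentation is enlarged to a relative one by
adding, for each generator of each `P`, one relation that expresses it in the free generators
(`coprodHom_ker_finitelyNormallyGenerated`). The cellular chain complex of the resulting coned-off
complex, written down algebraically, gives `P₂ → P₁ → P₀ → ℤ`. Exactness is checked objectwise. At a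
non-trivial `K` there are no edges or 2-cells and only one vertex. At the trivial subgroup,
exactness at the vertices is connectivity (`exists_edgeBoundary_eq`), and exactness at the edges is
relative Fox calculus (`exists_cellBoundary_eq`): the universal derivation modulo boundaries of
2-cells descends to `G` and splits off the quotient. The modules are projective because `ℤ[·, G/H]`
is representable, and the partial resolution is continued by covering kernels. If the collection is
empty, so is the orbit category, and every module is zero. -/

theorem isEdgePath_append {V D : Type u} {src tgt : D → V} : ∀ {p q : List D} {a b c : V},
    IsEdgePath src tgt a p b → IsEdgePath src tgt b q c → IsEdgePath src tgt a (p ++ q) c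
  | [], _, _, _, _, h, h' => by
    have h : _ = _ := h
    rw [h]
    exact h'
  | _ :: _, _, _, _, _, h, h' => ⟨h.1, isEdgePath_append h.2 h'⟩

theorem isEdgePath_map {V D V' D' : Type u} {src tgt : D → V} {src' tgt' : D' → V'}
    (f : V → V') (e : D → D') (hs : ∀ d, src' (e d) = f (src d)) (ht : ∀ d, tgt' (e d) = f (tgt d)) :
    ∀ {p : List D} {a b : V}, IsEdgePath src tgt a p b → IsEdgePath src' tgt' (f a) (p.map e) (f b)
  | [], _, _, h => congrArg f h
  | d :: _, _, _, h => by
    refine ⟨(hs d).trans (congrArg f h.1), ?_⟩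
    rw [ht]
    exact isEdgePath_map f e hs ht h.2

namespace TwoComplex

variable {X : TwoComplex.{u}} {a b c : X.V} {p q r : List X.D}

theorem IsPath.append (hp : X.IsPath a p b) (hq : X.IsPath b q c) : X.IsPath a (p ++ q) c :=
  isEdgePath_append hp hq

theorem IsPath.single (d : X.D) : X.IsPath (X.src d) [d] (X.tgt d) := ⟨rfl, rfl⟩

theorem tgt_rev (d : X.D) : X.tgt (X.rev d) = X.src d := congrArg X.src (X.rev_rev d)

theorem IsPath.backtrack (d : X.D) : X.IsPath (X.src d) [d, X.rev d] (X.src d) :=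
  ⟨rfl, rfl, tgt_rev d⟩

theorem Homotopic.refl (a b : X.V) (p : List X.D) : X.Homotopic a b p p := Relation.EqvGen.refl p

theorem Homotopic.symm (h : X.Homotopic a b p q) : X.Homotopic a b q p := Relation.EqvGen.symm _ _ h

theorem Homotopic.trans (h : X.Homotopic a b p q) (h' : X.Homotopic a b q r) :
    X.Homotopic a b p r := Relation.EqvGen.trans _ _ _ h h'

theorem Step.append_right (h : X.Step p q) (r : List X.D) : X.Step (p ++ r) (q ++ r) := by
  cases h with
  | backtrack p d q =>
    have := Step.backtrack (X := X) p d (q ++ r)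
    simpa using this
  | face p c q =>
    have := Step.face (X := X) p c (q ++ r)
    simpa using this

theorem Step.append_left (h : X.Step p q) (r : List X.D) : X.Step (r ++ p) (r ++ q) := by
  cases h with
  | backtrack p d q =>
    have := Step.backtrack (X := X) (r ++ p) d q
    simpa using this
  | face p c q =>
    have := Step.face (X := X) (r ++ p) c q
    simpa using this

theorem Homotopic.append_right (h : X.Homotopic a b p q) (hr : X.IsPath b r c) :
    X.Homotopic a c (p ++ r) (q ++ r) := by
  induction h with
  | rel p q h => exact .rel _ _ ⟨h.1.append hr, h.2.1.append hr, h.2.2.append_right r⟩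
  | refl p => exact Relation.EqvGen.refl _
  | symm p q _ ih => exact Relation.EqvGen.symm _ _ ih
  | trans p q s _ _ ih ih' => exact Relation.EqvGen.trans _ _ _ ih ih'

theorem Homotopic.append_left (h : X.Homotopic b c p q) (hr : X.IsPath a r b) :
    X.Homotopic a c (r ++ p) (r ++ q) := by
  induction h with
  | rel p q h => exact .rel _ _ ⟨hr.append h.1, hr.append h.2.1, h.2.2.append_left r⟩
  | refl p => exact Relation.EqvGen.refl _
  | symm p q _ ih => exact Relation.EqvGen.symm _ _ ih
  | trans p q s _ _ ih ih' => exact Relation.EqvGen.trans _ _ _ ih ih'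

theorem Homotopic.append_left_nil (h : X.Homotopic b b p []) (hr : X.IsPath a r b) :
    X.Homotopic a b (r ++ p) r := by
  simpa using h.append_left hr

theorem homotopic_backtrack (d : X.D) : X.Homotopic (X.src d) (X.src d) [d, X.rev d] [] :=
  .rel _ _ ⟨.backtrack d, rfl, .backtrack [] d []⟩

theorem homotopic_bdry (c : X.C) : X.Homotopic (X.base c) (X.base c) (X.bdry c) [] := by
  refine .rel _ _ ⟨X.bdry_closed c, rfl, ?_⟩
  have := Step.face (X := X) [] c []
  simpa using this

/-- Null-homotopy of closed paths may be checked after conjugation by an edge. -/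
theorem homotopic_nil_of_conj (d : X.D) (hp : X.IsPath (X.src d) p (X.src d))
    (h : X.Homotopic (X.tgt d) (X.tgt d) (X.rev d :: p ++ [d]) []) :
    X.Homotopic (X.src d) (X.src d) p [] := by
  have hd : X.IsPath (X.src d) [d] (X.tgt d) := .single d
  have hr : X.IsPath (X.tgt d) [X.rev d] (X.src d) := ⟨rfl, tgt_rev d⟩
  have hb := homotopic_backtrack d
  have h1 : X.Homotopic (X.src d) (X.src d) p ([d, X.rev d] ++ p) := (hb.append_right hp).symm
  have h2 : X.Homotopic (X.src d) (X.src d) ([d, X.rev d] ++ p)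
      (([d, X.rev d] ++ p) ++ [d, X.rev d]) := by
    have := (hb.append_left ((hd.append hr).append hp)).symm
    simpa using this
  have h3 := (h.append_right hr).append_left hd
  -- With `d⁻¹` the reverse of `d`: `p` is homotopic to `d (d⁻¹ p d) d⁻¹`, whose bracket is
  -- null-homotopic by hypothesis.
  refine h1.trans (h2.trans ?_)
  refine Homotopic.trans ?_ hb
  simpa using h3

end TwoComplex

/-- The fixed subcomplex has the same cells as `X`, each bundled with a proof of being fixed; paths
and elementary homotopies are carried across this bundling. -/
theorem GTwoComplex.simplyConnected_fixed {G : Type u} [Group G] (X : GTwoComplex G)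
    {K : Subgroup G} (hK : X.FixesAll K) (hX : X.toTwoComplex.SimplyConnected) :
    (X.fixed K).SimplyConnected := by
  obtain ⟨⟨v⟩, hc, hs⟩ := hX
  let eV : X.V → (X.fixed K).V := fun v => ⟨v, fun k hk => hK.1 k hk v⟩
  let eD : X.D → (X.fixed K).D := fun d => ⟨d, fun k hk => hK.2.1 k hk d⟩
  let eC : X.C → (X.fixed K).C := fun c => ⟨c, fun k hk => hK.2.2 k hk c⟩
  have hpath : ∀ {a b : X.V} {p : List X.D}, X.toTwoComplex.IsPath a p b →
      (X.fixed K).IsPath (eV a) (p.map eD) (eV b) :=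
    fun h => isEdgePath_map eV eD (fun _ => rfl) (fun _ => rfl) h
  have hbdry : ∀ c : X.C, (X.bdry c).map eD = (X.fixed K).bdry (eC c) := by
    intro c
    apply List.map_injective_iff.mpr Subtype.val_injective
    have h1 : ((X.bdry c).map eD).map Subtype.val = X.bdry c :=
      List.map_map.trans (List.map_id _)
    exact h1.trans (List.attachWith_map_subtype_val _).symm
  have hstep : ∀ {p q : List X.D}, X.toTwoComplex.Step p q →
      (X.fixed K).Step (p.map eD) (q.map eD) := by
    intro p q h
    cases h with
    | backtrack p d q =>
      simp only [List.map_append, List.map_cons]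
      exact TwoComplex.Step.backtrack (X := X.fixed K) (p.map eD) (eD d) (q.map eD)
    | face p c q =>
      simpa only [List.map_append, hbdry] using
        TwoComplex.Step.face (X := X.fixed K) (p.map eD) (eC c) (q.map eD)
  have hhom : ∀ {a b : X.V} {p q : List X.D}, X.toTwoComplex.Homotopic a b p q →
      (X.fixed K).Homotopic (eV a) (eV b) (p.map eD) (q.map eD) := by
    intro a b p q h
    induction h with
    | rel p q h => exact .rel _ _ ⟨hpath h.1, hpath h.2.1, hstep h.2.2⟩
    | refl p => exact Relation.EqvGen.refl _
    | symm p q _ ih => exact Relation.EqvGen.symm _ _ ih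
    | trans p q s _ _ ih ih' => exact Relation.EqvGen.trans _ _ _ ih ih'
  refine ⟨⟨eV v⟩, fun a b => ?_, fun a p hp => ?_⟩
  · obtain ⟨p, hp⟩ := hc a.1 b.1
    exact ⟨_, hpath hp⟩
  · have hp' : X.toTwoComplex.IsPath a.1 (p.map Subtype.val) a.1 :=
      isEdgePath_map (src := (X.fixed K).src) (tgt := (X.fixed K).tgt)
        Subtype.val Subtype.val (fun _ => rfl) (fun _ => rfl) hp
    have h := hhom (hs a.1 _ hp')
    have he : (p.map Subtype.val).map eD = p := List.map_map.trans (List.map_id p)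
    exact Eq.subst (motive := fun q => (X.fixed K).Homotopic a a q []) he h

theorem TwoComplex.IsPoint.simplyConnected {X : TwoComplex.{u}} (hX : X.IsPoint) :
    X.SimplyConnected := by
  obtain ⟨⟨v, -, hv⟩, hD, -⟩ := hX
  refine ⟨⟨v⟩, fun a b => ⟨[], (hv a trivial).trans (hv b trivial).symm⟩, fun a p _ => ?_⟩
  cases p with
  | nil => exact .refl _ _ _
  | cons d p => exact hD.elim d

/-! ### The edge-path group of the coned-off Cayley complex -/

section Cover

variable {G : Type u} [Group G] {𝓟 : Set (Subgroup G)}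

/-- The formal inverse of a letter. -/
def RelLetter.inv {S : Set G} : RelLetter 𝓟 S → RelLetter 𝓟 S
  | gen s ε => gen s !ε
  | per P p => per P p⁻¹

theorem RelLetter.val_inv {S : Set G} (x : RelLetter 𝓟 S) : x.inv.val = x.val⁻¹ := by
  rcases x with ⟨s, _ | _⟩ | ⟨P, p⟩ <;> simp [inv, val]

theorem RelLetter.inv_inv {S : Set G} (x : RelLetter 𝓟 S) : x.inv.inv = x := by
  rcases x with ⟨s, _ | _⟩ | ⟨P, p⟩ <;> simp [inv]

theorem CayleyLabel.ofGen_not {S : Set G} (s : S) (ε : Bool) :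
    CayleyLabel.ofGen s (!ε) = (CayleyLabel.ofGen s ε).inv := by
  cases ε
  · exact (CayleyLabel.inv_inv _).symm
  · rfl

/-- This lets a Cayley edge be read as a letter. If `x² = 1` then `x ∈ S`, and the two flags are the
generator and its formal inverse; otherwise the flag is `true`, and `x` is a generator or the
inverse of one. -/
theorem CayleyLabel.exists_ofGen {S : Set G} (x : CayleyLabel S) :
    ∃ s ε, x = CayleyLabel.ofGen s ε := by
  obtain ⟨⟨x, b⟩, hx, hb⟩ := x
  by_cases h : x * x = 1
  · have hinv : x⁻¹ = x := inv_eq_of_mul_eq_one_left h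
    have hS : x ∈ S := by simpa [hinv] using hx
    cases b
    · exact ⟨⟨x, hS⟩, false, Subtype.ext (by simp [ofGen, CayleyLabel.inv, h, hinv])⟩
    · exact ⟨⟨x, hS⟩, true, rfl⟩
  · have hb : b = true := hb h
    subst hb
    rcases hx with hx | hx
    · exact ⟨⟨x, hx⟩, true, rfl⟩
    · refine ⟨⟨x⁻¹, hx⟩, false, Subtype.ext ?_⟩
      have h' : ¬ x⁻¹ * x⁻¹ = 1 := by rwa [← mul_inv_rev, inv_eq_one]
      simp [ofGen, CayleyLabel.inv, h']

namespace FiniteRelPresentation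

variable (pres : FiniteRelPresentation 𝓟)

theorem isPath_wordPath (w : List (RelLetter 𝓟 pres.S)) (g : G) :
    pres.conedOffCayleyComplex.toTwoComplex.IsPath (.elem g) (wordPath g w)
      (.elem (g * (w.map RelLetter.val).prod)) :=
  isEdgePath_wordPath w g

theorem isPath_letterPath (x : RelLetter 𝓟 pres.S) (g : G) :
    pres.conedOffCayleyComplex.toTwoComplex.IsPath (.elem g) (letterPath g x) (.elem (g * x.val)) := by
  simpa [wordPath] using pres.isPath_wordPath [x] g

/-- Every edge path between elements of `G` is labelled by a word. -/
theorem exists_wordPath : ∀ (n : ℕ) (p : List (ConedDart 𝓟 pres.S)) (g h : G), p.length ≤ n →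
    pres.conedOffCayleyComplex.toTwoComplex.IsPath (.elem g) p (.elem h) →
      ∃ w : List (RelLetter 𝓟 pres.S), p = wordPath g w ∧ h = g * (w.map RelLetter.val).prod
  -- The induction is on a bound for the length, since a letter from some `P` uses two edges at
  -- once.
  | _, [], g, h, _, hp => by
    have e : g = h := ConedVertex.elem.inj hp
    exact ⟨[], rfl, by simp [e]⟩
  | 0, _ :: _, _, _, hn, _ => by simp at hn
  | n + 1, .cayley g' x :: p, g, h, hn, hp => by
    have e : g' = g := ConedVertex.elem.inj hp.1
    subst e
    obtain ⟨s, ε, rfl⟩ := x.exists_ofGen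
    have hv : (CayleyLabel.ofGen s ε).1.1 = (RelLetter.gen (𝓟 := 𝓟) s ε).val := by
      cases ε <;> rfl
    have hp' : pres.conedOffCayleyComplex.toTwoComplex.IsPath
      (.elem (g' * (CayleyLabel.ofGen s ε).1.1)) p (.elem h) := hp.2
    obtain ⟨w, rfl, rfl⟩ := exists_wordPath n p _ h (by simpa using hn) hp'
    exact ⟨.gen s ε :: w, by simp [wordPath, letterPath, hv], by simp [hv, mul_assoc]⟩
  | n + 1, .cone P g' true :: p, g, h, hn, hp => by
    exact ConedVertex.noConfusion rfl (heq_of_eq rfl) (heq_of_eq rfl) (heq_of_eq hp.1)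
  | n + 1, [.cone P g' false], g, h, hn, hp => by
    exact ConedVertex.noConfusion rfl (heq_of_eq rfl) (heq_of_eq rfl) (heq_of_eq hp.2)
  | n + 1, .cone P g' false :: .cayley k x :: p, g, h, hn, hp => by
    exact ConedVertex.noConfusion rfl (heq_of_eq rfl) (heq_of_eq rfl) (heq_of_eq hp.2.1)
  | n + 1, .cone P g' false :: .cone P' k false :: p, g, h, hn, hp => by
    exact ConedVertex.noConfusion rfl (heq_of_eq rfl) (heq_of_eq rfl) (heq_of_eq hp.2.1)
  -- A path entering a cone-vertex must leave it to an element `k` of the same coset, so the two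
  -- edges spell the letter `g'⁻¹ k`.
  | n + 1, .cone P g' false :: .cone P' k true :: p, g, h, hn, hp => by
    have e : g' = g := ConedVertex.elem.inj hp.1
    subst e
    have e2 : (ConedVertex.cone P' (QuotientGroup.mk k) : ConedVertex 𝓟) =
      .cone P (QuotientGroup.mk g') := hp.2.1
    obtain ⟨e3, e4⟩ := ConedVertex.cone.inj e2
    subst e3
    have hk : g'⁻¹ * k ∈ P'.1 := QuotientGroup.eq.mp (eq_of_heq e4).symm
    have hp' : pres.conedOffCayleyComplex.toTwoComplex.IsPath (.elem k) p (.elem h) := hp.2.2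
    obtain ⟨w, rfl, rfl⟩ := exists_wordPath n p _ h (by simp at hn; omega) hp'
    exact ⟨.per P' ⟨_, hk⟩ :: w, by simp [wordPath, letterPath, RelLetter.val],
      by simp [RelLetter.val, mul_assoc]⟩

/-! ### Monodromy on homotopy classes of paths -/

variable (a : ConedVertex 𝓟)

/-- Edge paths from `a` to an element of `G`, together with their endpoint. -/
def BasedPath : Type u :=
  {y : G × List (ConedDart 𝓟 pres.S) //
    pres.conedOffCayleyComplex.toTwoComplex.IsPath a y.2 (.elem y.1)}

instance basedPathSetoid : Setoid (pres.BasedPath a) where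
  r y z := y.1.1 = z.1.1 ∧
    pres.conedOffCayleyComplex.toTwoComplex.Homotopic a (.elem y.1.1) y.1.2 z.1.2
  iseqv :=
    { refl := fun _ => ⟨rfl, .refl _ _ _⟩
      symm := fun {y z} h => ⟨h.1.symm, h.1 ▸ h.2.symm⟩
      trans := fun {x y z} h h' => ⟨h.1.trans h'.1, h.2.trans (by rw [h.1]; exact h'.2)⟩ }

/-- The fibre over `G` of the universal cover of the coned-off Cayley complex: homotopy classes of
edge paths from `a` to elements of `G`. -/
def PathClass : Type u := Quotient (pres.basedPathSetoid a)

variable {pres a}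

/-- Append the edge path labelled by a letter. -/
noncomputable def BasedPath.appendLetter (x : RelLetter 𝓟 pres.S) (y : pres.BasedPath a) :
    pres.BasedPath a :=
  ⟨(y.1.1 * x.val, y.1.2 ++ letterPath y.1.1 x), y.2.append (pres.isPath_letterPath x y.1.1)⟩

/-- Append the edge path labelled by a word. -/
noncomputable def BasedPath.appendWord (w : List (RelLetter 𝓟 pres.S)) (y : pres.BasedPath a) :
    pres.BasedPath a :=
  ⟨(y.1.1 * (w.map RelLetter.val).prod, y.1.2 ++ wordPath y.1.1 w),
    y.2.append (pres.isPath_wordPath w y.1.1)⟩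

/-- Append the edge path labelled by a letter to a homotopy class. -/
noncomputable def PathClass.appendLetter (x : RelLetter 𝓟 pres.S) :
    pres.PathClass a → pres.PathClass a :=
  Quotient.map (BasedPath.appendLetter x) fun y z h => by
    obtain ⟨⟨g, p⟩, hp⟩ := y
    obtain ⟨⟨g', p'⟩, hp'⟩ := z
    obtain ⟨h1, h2⟩ := h
    dsimp only at h1 h2
    subst h1
    exact ⟨rfl, h2.append_right (pres.isPath_letterPath x g)⟩

/-- For a generator this is one backtrack. For `p ∈ P` the path is `g, v(gP), gp, v(gP), g`: the
inner backtrack is deleted first, then the outer one. -/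
theorem homotopic_letterPath_inv (x : RelLetter 𝓟 pres.S) (g : G) :
    pres.conedOffCayleyComplex.toTwoComplex.Homotopic (.elem g) (.elem g)
      (letterPath g x ++ letterPath (g * x.val) x.inv) [] := by
  rcases x with ⟨s, ε⟩ | ⟨P, p⟩
  · have hv : (CayleyLabel.ofGen s ε).1.1 = (RelLetter.gen (𝓟 := 𝓟) s ε).val := by
      cases ε <;> rfl
    have := TwoComplex.homotopic_backtrack (X := pres.conedOffCayleyComplex.toTwoComplex)
      (ConedDart.cayley g (CayleyLabel.ofGen s ε))
    simp only [letterPath, RelLetter.inv, CayleyLabel.ofGen_not, ← hv]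
    exact this
  · have h1 : pres.conedOffCayleyComplex.toTwoComplex.IsPath (.elem g) [ConedDart.cone P g false]
      (.cone P (QuotientGroup.mk g)) := ⟨rfl, rfl⟩
    have h2 : pres.conedOffCayleyComplex.toTwoComplex.IsPath (.cone P (QuotientGroup.mk g))
      [ConedDart.cone P g true] (.elem g) := ⟨rfl, rfl⟩
    have hc : (QuotientGroup.mk (g * p.1) : G ⧸ P.1) = QuotientGroup.mk g :=
      QuotientGroup.mk_mul_of_mem g p.2
    have h3 : pres.conedOffCayleyComplex.toTwoComplex.Homotopic (.cone P (QuotientGroup.mk g))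
      (.cone P (QuotientGroup.mk g))
      [ConedDart.cone P (g * p.1) true, ConedDart.cone P (g * p.1) false] [] := by
      rw [← hc]
      exact TwoComplex.homotopic_backtrack (X := pres.conedOffCayleyComplex.toTwoComplex)
        (ConedDart.cone P (g * p.1) true)
    have h4 := (h3.append_left h1).append_right h2
    have h5 := TwoComplex.homotopic_backtrack (X := pres.conedOffCayleyComplex.toTwoComplex)
      (ConedDart.cone P g false)
    have h6 := h4.trans h5
    simp only [letterPath, RelLetter.inv, RelLetter.val, InvMemClass.coe_inv, mul_inv_cancel_right]
    exact h6

/-- Deleting the excursion `v(gP), gp, v(gP)` suffices, so the multiplication table of `P` holds in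
the edge-path groupoid without any 2-cells. -/
theorem homotopic_letterPath_mul (P : 𝓟) (p q : P.1) (g : G) :
    pres.conedOffCayleyComplex.toTwoComplex.Homotopic (.elem g) (.elem (g * (p * q : P.1)))
      (letterPath g (.per P p) ++ letterPath (g * p.1) (.per P q)) (letterPath g (.per P (p * q))) := by
  have h1 : pres.conedOffCayleyComplex.toTwoComplex.IsPath (.elem g) [ConedDart.cone P g false]
    (.cone P (QuotientGroup.mk g)) := ⟨rfl, rfl⟩
  have hc : (QuotientGroup.mk (g * p.1) : G ⧸ P.1) = QuotientGroup.mk g :=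
    QuotientGroup.mk_mul_of_mem g p.2
  have hc' : (QuotientGroup.mk (g * (p * q : P.1).1) : G ⧸ P.1) = QuotientGroup.mk g :=
    QuotientGroup.mk_mul_of_mem g (p * q).2
  have h2 : pres.conedOffCayleyComplex.toTwoComplex.IsPath (.cone P (QuotientGroup.mk g))
      [ConedDart.cone P (g * (p * q : P.1).1) true] (.elem (g * (p * q : P.1).1)) :=
    ⟨congrArg (ConedVertex.cone P) hc', rfl⟩
  have h3 : pres.conedOffCayleyComplex.toTwoComplex.Homotopic (.cone P (QuotientGroup.mk g))
    (.cone P (QuotientGroup.mk g))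
    [ConedDart.cone P (g * p.1) true, ConedDart.cone P (g * p.1) false] [] := by
    rw [← hc]
    exact TwoComplex.homotopic_backtrack (X := pres.conedOffCayleyComplex.toTwoComplex)
      (ConedDart.cone P (g * p.1) true)
  have h4 := (h3.append_left h1).append_right h2
  simp only [letterPath, mul_assoc]
  exact h4

theorem PathClass.appendLetter_inv (x : RelLetter 𝓟 pres.S) (y : pres.PathClass a) :
    appendLetter x.inv (appendLetter x y) = y := by
  induction y using Quotient.inductionOn with
  | h y =>
    refine Quotient.sound ⟨?_, ?_⟩
    · simp [BasedPath.appendLetter, RelLetter.val_inv]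
    · simp only [BasedPath.appendLetter, RelLetter.val_inv, mul_inv_cancel_right, List.append_assoc]
      exact (homotopic_letterPath_inv x y.1.1).append_left_nil y.2

theorem PathClass.appendLetter_mul (P : 𝓟) (p q : P.1) (y : pres.PathClass a) :
    appendLetter (.per P q) (appendLetter (.per P p) y) = appendLetter (.per P (p * q)) y := by
  induction y using Quotient.inductionOn with
  | h y =>
    refine Quotient.sound ⟨?_, ?_⟩
    · simp [BasedPath.appendLetter, RelLetter.val, mul_assoc]
    · simp only [BasedPath.appendLetter, RelLetter.val, List.append_assoc, mul_assoc]
      exact (homotopic_letterPath_mul P p q y.1.1).append_left y.2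

/-- The permutation of the homotopy classes given by appending a letter. -/
noncomputable def letterPerm (x : RelLetter 𝓟 pres.S) : Equiv.Perm (pres.PathClass a) where
  toFun := PathClass.appendLetter x
  invFun := PathClass.appendLetter x.inv
  left_inv := PathClass.appendLetter_inv x
  right_inv y := by simpa [RelLetter.inv_inv] using PathClass.appendLetter_inv x.inv y

variable (pres a)

/-- The right action of the free product on the homotopy classes of paths starting at `a`. -/
noncomputable def monodromy : RelFree 𝓟 pres.S →* (Equiv.Perm (pres.PathClass a))ᵐᵒᵖ :=
  Monoid.Coprod.lift
    (Monoid.CoprodI.lift fun P : 𝓟 =>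
      MonoidHom.mk' (fun p : P.1 => MulOpposite.op (letterPerm (.per P p))) fun p q => by
        rw [← MulOpposite.op_mul]
        exact congrArg _ (Equiv.ext fun y => (PathClass.appendLetter_mul P p q y).symm))
    (FreeGroup.lift fun s => MulOpposite.op (letterPerm (.gen s true)))

theorem monodromy_toFree (x : RelLetter 𝓟 pres.S) :
    pres.monodromy a x.toFree = MulOpposite.op (letterPerm x) := by
  rcases x with ⟨s, _ | _⟩ | ⟨P, p⟩
  · simp only [RelLetter.toFree, monodromy, map_inv, Monoid.Coprod.lift_apply_inr,
      FreeGroup.lift_apply_of, ← MulOpposite.op_inv]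
    rfl
  · simp [RelLetter.toFree, monodromy]
  · simp [RelLetter.toFree, monodromy]

theorem monodromy_word : ∀ (w : List (RelLetter 𝓟 pres.S)) (y : pres.BasedPath a),
    (pres.monodromy a (relWordToFree w)).unop (Quotient.mk _ y) =
      Quotient.mk _ (BasedPath.appendWord w y)
  | [], y => by
    refine congrArg (Quotient.mk _) (Subtype.ext (Prod.ext ?_ ?_)) <;>
      simp [BasedPath.appendWord, wordPath]
  | x :: w, y => by
    have h : relWordToFree (x :: w) = x.toFree * relWordToFree w := by simp [relWordToFree]
    rw [h, map_mul, MulOpposite.unop_mul, monodromy_toFree]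
    refine (monodromy_word w (BasedPath.appendLetter x y)).trans ?_
    refine congrArg (Quotient.mk _) (Subtype.ext (Prod.ext ?_ ?_)) <;>
      simp [BasedPath.appendWord, BasedPath.appendLetter, wordPath, mul_assoc]

/-- The appended loop is the boundary of the 2-cell of `r` based at the endpoint of the path. -/
theorem monodromy_relator (r : pres.R) : pres.monodromy a (relWordToFree r.1) = 1 := by
  refine MulOpposite.unop_injective (Equiv.ext fun y => ?_)
  induction y using Quotient.inductionOn with
  | h y =>
    rw [monodromy_word]
    refine Quotient.sound ⟨?_, ?_⟩
    · simp [BasedPath.appendWord, pres.relator_val]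
    · simp only [BasedPath.appendWord, pres.relator_val, mul_one]
      exact (TwoComplex.homotopic_bdry (X := pres.conedOffCayleyComplex.toTwoComplex)
        (y.1.1, r)).append_left_nil y.2

theorem relFreeHom_relWordToFree {S : Set G} (w : List (RelLetter 𝓟 S)) :
    relFreeHom 𝓟 S (relWordToFree w) = (w.map RelLetter.val).prod := by
  rw [relWordToFree, map_list_prod, List.map_map]
  congr 1
  exact List.map_congr_left fun x _ => RelLetter.relFreeHom_toFree x

/-- The label of the loop lies in the normal closure of the relators, so its monodromy is the
identity; evaluating at the constant path identifies the class of the loop with the trivial class.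
-/
theorem homotopic_nil_of_elem (g : G) (p : List (ConedDart 𝓟 pres.S))
    (hp : pres.conedOffCayleyComplex.toTwoComplex.IsPath (.elem g) p (.elem g)) :
    pres.conedOffCayleyComplex.toTwoComplex.Homotopic (.elem g) (.elem g) p [] := by
  obtain ⟨w, rfl, hw⟩ := pres.exists_wordPath _ p g g le_rfl hp
  have hw : (w.map RelLetter.val).prod = 1 := by simpa using hw
  have hker : relWordToFree w ∈ (relFreeHom 𝓟 pres.S).ker := by
    rw [MonoidHom.mem_ker, relFreeHom_relWordToFree, hw]
  have hle : (relFreeHom 𝓟 pres.S).ker ≤ (pres.monodromy (.elem g)).ker := by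
    rw [pres.ker_eq]
    refine Subgroup.normalClosure_le_normal ?_
    rintro _ ⟨r, hr, rfl⟩
    exact pres.monodromy_relator _ ⟨r, hr⟩
  have h1 : pres.monodromy (.elem g) (relWordToFree w) = 1 := hle hker
  let y : pres.BasedPath (.elem g) := ⟨(g, []), rfl⟩
  have h2 := pres.monodromy_word (.elem g) w y
  rw [h1] at h2
  have h3 : y ≈ BasedPath.appendWord w y := Quotient.exact h2
  exact h3.2.symm

theorem exists_relWord (x : RelFree 𝓟 pres.S) :
    ∃ w : List (RelLetter 𝓟 pres.S), (w.map RelLetter.val).prod = relFreeHom 𝓟 pres.S x := by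
  -- A submonoid is enough, because formal inverses of generators are themselves letters.
  let M : Submonoid G :=
    { carrier := {g | ∃ w : List (RelLetter 𝓟 pres.S), (w.map RelLetter.val).prod = g}
      one_mem' := ⟨[], rfl⟩
      mul_mem' := by
        rintro _ _ ⟨w, rfl⟩ ⟨w', rfl⟩
        exact ⟨w ++ w', by simp⟩ }
  change relFreeHom 𝓟 pres.S x ∈ M
  have hletter : ∀ l : RelLetter 𝓟 pres.S, l.val ∈ M := fun l => ⟨[l], by simp⟩
  induction x using Monoid.Coprod.induction_on with
  | inl x =>
    induction x using Monoid.CoprodI.induction_on with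
    | one => simp [M.one_mem]
    | of P p => simpa [relFreeHom, RelLetter.val] using hletter (.per P p)
    | mul x y hx hy => simpa using M.mul_mem hx hy
  | inr x =>
    induction x using FreeGroup.induction_on with
    | C1 => simp [M.one_mem]
    | of s => simpa [relFreeHom, RelLetter.val] using hletter (.gen s true)
    | inv_of s _ => simpa [relFreeHom, RelLetter.val] using hletter (.gen s false)
    | mul x y hx hy => simpa using M.mul_mem hx hy
  | mul x y hx hy => simpa using M.mul_mem hx hy

/-- Connectivity comes from surjectivity of the free product onto `G`. A loop at a cone-vertex is
conjugated along a cone edge to a loop at an element of `G`. -/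
theorem simplyConnected : pres.conedOffCayleyComplex.toTwoComplex.SimplyConnected := by
  have hto : ∀ b : ConedVertex 𝓟, ∃ g q q',
      pres.conedOffCayleyComplex.toTwoComplex.IsPath (.elem g) q b ∧
        pres.conedOffCayleyComplex.toTwoComplex.IsPath b q' (.elem g) := by
    rintro (g | ⟨P, x⟩)
    · exact ⟨g, [], [], rfl, rfl⟩
    · induction x using QuotientGroup.induction_on with
      | H g => exact ⟨g, [ConedDart.cone P g false], [ConedDart.cone P g true], ⟨rfl, rfl⟩, rfl, rfl⟩
  refine ⟨⟨ConedVertex.elem 1⟩, fun a b => ?_, ?_⟩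
  · obtain ⟨g, -, q, -, hq⟩ := hto a
    obtain ⟨h, q', -, hq', -⟩ := hto b
    obtain ⟨x, hx⟩ := pres.surjective (g⁻¹ * h)
    obtain ⟨w, hw⟩ := pres.exists_relWord x
    have h1 := pres.isPath_wordPath w g
    rw [hw, hx, mul_inv_cancel_left] at h1
    exact ⟨_, (hq.append h1).append hq'⟩
  · rintro (g | ⟨P, x⟩) p hp
    · exact pres.homotopic_nil_of_elem g p hp
    · induction x using QuotientGroup.induction_on with
      | H g =>
        refine TwoComplex.homotopic_nil_of_conj (X := pres.conedOffCayleyComplex.toTwoComplex)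
          (ConedDart.cone P g true) hp (pres.homotopic_nil_of_elem g _ ?_)
        have h1 : pres.conedOffCayleyComplex.toTwoComplex.IsPath (.elem g)
          [ConedDart.cone P g false] (.cone P (QuotientGroup.mk g)) := ⟨rfl, rfl⟩
        have h2 : pres.conedOffCayleyComplex.toTwoComplex.IsPath (.cone P (QuotientGroup.mk g))
          [ConedDart.cone P g true] (.elem g) := ⟨rfl, rfl⟩
        exact (h1.append hp).append h2

end FiniteRelPresentation

end Cover

/-! ### Isotropy and fixed points -/

section Isotropy

variable {G : Type u} [Group G] {𝓟 : Set (Subgroup G)}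

theorem bot_mem_generatedFamily (h : 𝓟.Nonempty) : ⊥ ∈ generatedFamily 𝓟 := by
  obtain ⟨P, hP⟩ := h
  refine ⟨1, P, hP, fun k hk => ?_⟩
  rw [Subgroup.mem_bot.mp hk]
  simp [P.one_mem]

namespace ConedVertex

theorem smul_elem (g h : G) : g • (elem h : ConedVertex 𝓟) = elem (g * h) := rfl

theorem smul_cone (g h : G) (P : 𝓟) :
    g • (cone P (QuotientGroup.mk h) : ConedVertex 𝓟) = cone P (QuotientGroup.mk (g * h)) := rfl

theorem smul_elem_eq_iff {g h : G} : g • (elem h : ConedVertex 𝓟) = elem h ↔ g = 1 := by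
  rw [smul_elem, elem.injEq, mul_eq_right]

theorem smul_cone_eq_iff {g h : G} {P : 𝓟} :
    g • (cone P (QuotientGroup.mk h) : ConedVertex 𝓟) = cone P (QuotientGroup.mk h) ↔
      h⁻¹ * g * h ∈ P.1 := by
  rw [smul_cone, cone.injEq, heq_eq_eq, and_iff_right rfl, eq_comm, QuotientGroup.eq, mul_assoc]

theorem stabilizer_mem (v : ConedVertex 𝓟) (h : 𝓟.Nonempty) :
    MulAction.stabilizer G v ∈ generatedFamily 𝓟 := by
  rcases v with g | ⟨P, x⟩
  · have : MulAction.stabilizer G (elem g : ConedVertex 𝓟) = ⊥ :=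
      (Subgroup.eq_bot_iff_forall _).mpr fun k hk => smul_elem_eq_iff.mp hk
    rw [this]
    exact bot_mem_generatedFamily h
  · induction x using QuotientGroup.induction_on with
    | H g => exact ⟨g, P.1, P.2, fun k hk => smul_cone_eq_iff.mp hk⟩

/-- A non-trivial member of the family generated by a malnormal collection fixes exactly one vertex,
and this vertex is a cone-vertex. -/
theorem existsUnique_fixed (hmal : IsMalnormalCollection 𝓟) {K : Subgroup G}
    (hK : K ∈ generatedFamily 𝓟) (hne : K ≠ ⊥) :
    ∃! v : ConedVertex 𝓟, ∀ k ∈ K, k • v = v := by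
  obtain ⟨g, P, hP, hg⟩ := hK
  obtain ⟨k, hk, hk1⟩ := K.bot_or_exists_ne_one.resolve_left hne
  refine ⟨cone ⟨P, hP⟩ (QuotientGroup.mk g), fun k hk => smul_cone_eq_iff.mpr (hg k hk), ?_⟩
  rintro (h | ⟨P', x⟩) hv
  · exact absurd (smul_elem_eq_iff.mp (hv k hk)) hk1
  · induction x using QuotientGroup.induction_on with
    | H h =>
      have h1 := smul_cone_eq_iff.mp (hv k hk)
      have e : (g⁻¹ * h)⁻¹ * (g⁻¹ * k * g) * (g⁻¹ * h) = h⁻¹ * k * h := by group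
      -- The element `g⁻¹kg` lies in `P` and its conjugate by `g⁻¹h` lies in `P'`. The first
      -- alternative of malnormality would force `k = 1`; the second says that the two cosets agree.
      rcases hmal P hP P'.1 P'.2 (g⁻¹ * h) with h2 | ⟨rfl, h2⟩
      · have h3 := h2 _ (hg k hk)
        rw [e] at h3
        refine absurd (h3 h1) fun h4 => hk1 ?_
        have h5 : k = h * (h⁻¹ * k * h) * h⁻¹ := by group
        rw [h5, h4]
        group
      · exact congrArg (cone P') (QuotientGroup.eq.mpr h2).symm

end ConedVertex

theorem ConedDart.eq_one_of_smul_eq {S : Set G} {g : G} {d : ConedDart 𝓟 S} (h : g • d = d) :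
    g = 1 := by
  rcases d with ⟨k, x⟩ | ⟨P, k, b⟩
  · exact mul_eq_right.mp (ConedDart.cayley.inj h).1
  · exact mul_eq_right.mp (ConedDart.cone.inj h).2.1

theorem CayleyLabel.finite {S : Set G} (hS : S.Finite) : Finite (CayleyLabel S) := by
  have h : ((S ∪ S⁻¹) ×ˢ (Set.univ : Set Bool)).Finite := (hS.union hS.inv).prod Set.finite_univ
  refine (h.subset (t := {x : G × Bool | (x.1 ∈ S ∨ x.1⁻¹ ∈ S) ∧ (x.1 * x.1 ≠ 1 → x.2 = true)})
    ?_).to_subtype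
  exact fun x hx => ⟨hx.1, trivial⟩

theorem finite_orbits_of_surjective {T I : Type u} [MulAction G T] [Finite I] (f : I → T)
    (h : ∀ t : T, ∃ i, ∃ g : G, g • f i = t) : Finite (MulAction.orbitRel.Quotient G T) := by
  refine Finite.of_surjective (fun i => (Quotient.mk _ (f i) : MulAction.orbitRel.Quotient G T)) ?_
  intro x
  induction x using Quotient.inductionOn with
  | h t =>
    obtain ⟨i, g, rfl⟩ := h t
    exact ⟨i, Quotient.sound ⟨g⁻¹, inv_smul_smul g (f i)⟩⟩

theorem ConedVertex.finite_orbits (hfin : 𝓟.Finite) :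
    Finite (MulAction.orbitRel.Quotient G (ConedVertex 𝓟)) := by
  have := hfin.to_subtype
  refine finite_orbits_of_surjective (I := PUnit.{u + 1} ⊕ 𝓟)
    (Sum.elim (fun _ => elem 1) fun P => cone P (QuotientGroup.mk 1)) ?_
  rintro (g | ⟨P, x⟩)
  · exact ⟨.inl ⟨⟩, g, congrArg elem (mul_one g)⟩
  · induction x using QuotientGroup.induction_on with
    | H g => exact ⟨.inr P, g, congrArg (fun h => cone P (QuotientGroup.mk h)) (mul_one g)⟩

theorem ConedDart.finite_orbits (hfin : 𝓟.Finite) {S : Set G} (hS : S.Finite) :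
    Finite (MulAction.orbitRel.Quotient G (ConedDart 𝓟 S)) := by
  have := hfin.to_subtype
  have := CayleyLabel.finite hS
  refine finite_orbits_of_surjective (I := CayleyLabel S ⊕ 𝓟 × Bool)
    (Sum.elim (fun x => cayley 1 x) fun x => cone x.1 1 x.2) ?_
  rintro (⟨g, x⟩ | ⟨P, g, b⟩)
  · exact ⟨.inl x, g, congrArg (cayley · x) (mul_one g)⟩
  · exact ⟨.inr (P, b), g, congrArg (cone P · b) (mul_one g)⟩

namespace FiniteRelPresentation

variable (pres : FiniteRelPresentation 𝓟)

theorem edgeStabilizer_eq_bot (d : pres.conedOffCayleyComplex.D) :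
    pres.conedOffCayleyComplex.edgeStabilizer d = ⊥ := by
  refine (Subgroup.eq_bot_iff_forall _).mpr fun g hg => ?_
  rcases hg with hg | hg
  · exact ConedDart.eq_one_of_smul_eq hg
  · exact absurd hg (ConedDart.no_inversion g d)

theorem eq_one_of_smul_cell_eq {g : G} {c : G × pres.R} (h : g • c = c) : g = 1 :=
  mul_eq_right.mp (congrArg Prod.fst h)

theorem fixesAll_bot : pres.conedOffCayleyComplex.FixesAll ⊥ := by
  refine ⟨?_, ?_, ?_⟩ <;>
  · intro k hk x
    rw [Subgroup.mem_bot.mp hk]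
    exact one_smul G x

/-- Malnormality settles the vertices; a fixed edge or 2-cell would make `K` trivial, since the
action on those is free. -/
theorem isPoint_fixed (hmal : IsMalnormalCollection 𝓟) {K : Subgroup G}
    (hK : K ∈ generatedFamily 𝓟) (hne : K ≠ ⊥) :
    (pres.conedOffCayleyComplex.fixed K).IsPoint := by
  obtain ⟨v, hv, huniq⟩ := ConedVertex.existsUnique_fixed hmal hK hne
  refine ⟨⟨⟨v, hv⟩, trivial, fun w _ => Subtype.ext (huniq w.1 w.2)⟩, ⟨fun d => hne ?_⟩,
    ⟨fun c => hne ?_⟩⟩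
  · exact (Subgroup.eq_bot_iff_forall _).mpr fun k hk => ConedDart.eq_one_of_smul_eq (d.2 k hk)
  · exact (Subgroup.eq_bot_iff_forall _).mpr fun k hk => pres.eq_one_of_smul_cell_eq (c.2 k hk)

theorem isPoint_or_fixesAll (hmal : IsMalnormalCollection 𝓟) {K : Subgroup G}
    (hK : K ∈ generatedFamily 𝓟) : (pres.conedOffCayleyComplex.fixed K).IsPoint ∨
      pres.conedOffCayleyComplex.FixesAll K := by
  by_cases h : K = ⊥
  · subst h
    exact Or.inr pres.fixesAll_bot
  · exact Or.inl (pres.isPoint_fixed hmal hK h)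

theorem isF2Complex (hfin : 𝓟.Finite) (hmal : IsMalnormalCollection 𝓟) (hne : 𝓟.Nonempty) :
    pres.conedOffCayleyComplex.IsF2Complex (generatedFamily 𝓟) where
  cocompact := by
    have := pres.finite_R.to_subtype
    refine ⟨ConedVertex.finite_orbits hfin, ConedDart.finite_orbits hfin pres.finite_S, ?_⟩
    exact finite_orbits_of_surjective (T := G × pres.R) (fun r : pres.R => ((1 : G), r))
      fun c => ⟨c.2, c.1, Prod.ext (mul_one c.1) rfl⟩
  isotropy := by
    refine ⟨fun v => ConedVertex.stabilizer_mem v hne, fun d => ?_, fun c => ?_⟩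
    · rw [pres.edgeStabilizer_eq_bot d]
      exact bot_mem_generatedFamily hne
    · have : MulAction.stabilizer G c = ⊥ :=
        (Subgroup.eq_bot_iff_forall _).mpr fun k hk => pres.eq_one_of_smul_cell_eq hk
      rw [this]
      exact bot_mem_generatedFamily hne
  fixed_simplyConnected K hK := by
    rcases pres.isPoint_or_fixesAll hmal hK with h | h
    · exact h.simplyConnected
    · exact GTwoComplex.simplyConnected_fixed _ h pres.simplyConnected

end FiniteRelPresentation

end Isotropy

/-! ### Relative presentations of finitely presented groups -/

section RelativePresentation

variable {G : Type u} [Group G]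

/-- The homomorphism `(∗_{P ∈ 𝓟} P) ∗ F → G` induced by a homomorphism `F → G`. -/
def coprodHom (𝓟 : Set (Subgroup G)) {F : Type u} [Group F] (φ : F →* G) :
    Monoid.Coprod (Monoid.CoprodI fun P : 𝓟 => P.1) F →* G :=
  Monoid.Coprod.lift (Monoid.CoprodI.lift fun P : 𝓟 => P.1.subtype) φ

/-- If `F → G` is onto with finitely normally generated kernel, and the finitely many members of `𝓟`
are finitely generated, then the kernel of `(∗_{P ∈ 𝓟} P) ∗ F → G` is finitely normally generated. -/
theorem coprodHom_ker_finitelyNormallyGenerated {𝓟 : Set (Subgroup G)} (hfin : 𝓟.Finite)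
    (hfg : ∀ P ∈ 𝓟, P.FG) {F : Type u} [Group F] {φ : F →* G} (hφ : Function.Surjective φ)
    (hker : φ.ker.IsFinitelyNormallyGenerated) :
    (coprodHom 𝓟 φ).ker.IsFinitelyNormallyGenerated := by
  classical
  obtain ⟨R, hR, hRker⟩ := hker
  have := hfin.to_subtype
  have hgen : ∀ P : 𝓟, ∃ X : Set P.1, X.Finite ∧ Subgroup.closure X = ⊤ := fun P => by
    have : Group.FG P.1 := (Group.fg_iff_subgroup_fg P.1).mpr (hfg P.1 P.2)
    obtain ⟨X, hX, hX'⟩ := Group.fg_iff.mp this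
    exact ⟨X, hX', hX⟩
  choose X hXfin hX using hgen
  choose w hw using hφ
  -- The relation identifies an element of `P` with a chosen lift to `F` of its image in `G`;
  -- imposing it on finite generating sets will suffice.
  let rel : (Σ P : 𝓟, P.1) → Monoid.Coprod (Monoid.CoprodI fun P : 𝓟 => P.1) F := fun x =>
    (Monoid.Coprod.inl (Monoid.CoprodI.of (M := fun P : 𝓟 => P.1) x.2))⁻¹ * Monoid.Coprod.inr (w x.2.1)
  let R' : Set (Monoid.Coprod (Monoid.CoprodI fun P : 𝓟 => P.1) F) :=
    Monoid.Coprod.inr '' R ∪ ⋃ P : 𝓟, (fun x => rel ⟨P, x⟩) '' X P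
  refine ⟨R', (hR.image _).union (Set.finite_iUnion fun P => (hXfin P).image _), ?_⟩
  apply le_antisymm
  · refine Subgroup.normalClosure_le_normal ?_
    rintro x (⟨r, hr, rfl⟩ | hx)
    · have hr' : r ∈ φ.ker := hRker ▸ Subgroup.subset_normalClosure hr
      simpa [coprodHom] using hr'
    · obtain ⟨P, y, hy, rfl⟩ := Set.mem_iUnion.mp hx
      simp [coprodHom, rel, hw, MonoidHom.mem_ker]
  · let N := Subgroup.normalClosure R'
    let ψ : F →* (Monoid.Coprod (Monoid.CoprodI fun P : 𝓟 => P.1) F) ⧸ N :=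
      (QuotientGroup.mk' N).comp Monoid.Coprod.inr
    have hψ : φ.ker ≤ ψ.ker := by
      rw [← hRker]
      refine Subgroup.normalClosure_le_normal fun r hr => ?_
      exact (QuotientGroup.eq_one_iff _).mpr
        (Subgroup.subset_normalClosure (Or.inl ⟨r, hr, rfl⟩))
    -- The kernel of `φ` dies modulo `N`, so `G` itself maps to the quotient.
    let σ : G →* (Monoid.Coprod (Monoid.CoprodI fun P : 𝓟 => P.1) F) ⧸ N :=
      φ.liftOfRightInverse w hw ⟨ψ, hψ⟩
    have hσ : ∀ x, σ (φ x) = ψ x := φ.liftOfRightInverse_comp_apply w hw ⟨ψ, hψ⟩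
    -- The quotient map factors through `G`, which puts the kernel inside `N`. On each `P` it is
    -- enough to compare generators, where the added relations apply.
    have key : σ.comp (coprodHom 𝓟 φ) = QuotientGroup.mk' N := by
      refine Monoid.Coprod.hom_ext (Monoid.CoprodI.ext_hom _ _ fun P => ?_) ?_
      · refine MonoidHom.eq_of_eqOn_dense (hX P) fun x hx => ?_
        have h1 : σ x.1 = ψ (w x.1) := by rw [← hσ, hw]
        have h2 : (QuotientGroup.mk' N) (rel ⟨P, x⟩) = 1 := (QuotientGroup.eq_one_iff _).mpr
          (Subgroup.subset_normalClosure (Or.inr (Set.mem_iUnion.mpr ⟨P, x, hx, rfl⟩)))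
        simp only [rel, map_mul, map_inv] at h2
        have h3 := inv_mul_eq_one.mp h2
        simp only [MonoidHom.comp_apply, coprodHom, Monoid.Coprod.lift_apply_inl,
          Monoid.CoprodI.lift_of, Subgroup.coe_subtype]
        exact h1.trans h3.symm
      · ext x
        simp [coprodHom, hσ, ψ]
    intro x hx
    have h1 := DFunLike.congr_fun key x
    rw [MonoidHom.comp_apply, MonoidHom.mem_ker.mp hx, map_one] at h1
    exact (QuotientGroup.eq_one_iff _).mp h1.symm

/-- A finitely presented group with a finite collection of finitely generated subgroups has a finite
relative presentation. -/
theorem exists_relativePresentation {𝓟 : Set (Subgroup G)} (hfin : 𝓟.Finite)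
    (hG : Group.IsFinitelyPresented G) (hfg : ∀ P ∈ 𝓟, P.FG) :
    ∃ (σ : Type u) (_ : Finite σ) (f : σ → G)
      (R : Set (Monoid.Coprod (Monoid.CoprodI fun P : 𝓟 => P.1) (FreeGroup σ))),
      R.Finite ∧ Function.Surjective (coprodHom 𝓟 (FreeGroup.lift f)) ∧
        Subgroup.normalClosure R = (coprodHom 𝓟 (FreeGroup.lift f)).ker := by
  obtain ⟨n, φ, hφ, hker⟩ := hG.out
  -- The generators are lifted to the universe of `G`.
  let e : FreeGroup (ULift.{u} (Fin n)) ≃* FreeGroup (Fin n) :=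
    FreeGroup.freeGroupCongr Equiv.ulift
  let f : ULift.{u} (Fin n) → G := fun i => φ (.of i.down)
  have hf : FreeGroup.lift f = φ.comp e.toMonoidHom := by
    ext i
    simp [f, e]
  have hsurj : Function.Surjective (FreeGroup.lift f) := by
    rw [hf]
    exact hφ.comp e.surjective
  have hker' : (FreeGroup.lift f).ker.IsFinitelyNormallyGenerated := by
    rw [hf]
    refine Subgroup.IsFinitelyNormallyGenerated.comap (f := e.toMonoidHom) hker e.surjective ?_
    have hbot : e.toMonoidHom.ker = ⊥ := (MonoidHom.ker_eq_bot_iff e.toMonoidHom).mpr e.injective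
    rw [hbot]
    exact .bot
  obtain ⟨R, hR, hR'⟩ := coprodHom_ker_finitelyNormallyGenerated hfin hfg hsurj hker'
  refine ⟨_, inferInstance, f, R, hR, fun g => ?_, hR'⟩
  obtain ⟨x, rfl⟩ := hsurj g
  exact ⟨Monoid.Coprod.inr x, Monoid.Coprod.lift_apply_inr ..⟩

end RelativePresentation

/-! ### Fox calculus relative to a collection of subgroups -/

section Fox

variable {G : Type u} [Group G]

/-! ### Affine actions and derivations -/

section Affine

variable {N : Type u} [AddCommGroup N]

/-- The affine permutation `n ↦ b + g • n` of a `G`-module. -/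
def affinePerm (ρ : Representation ℤ G N) (g : G) (b : N) : Equiv.Perm N where
  toFun n := b + ρ g n
  invFun n := ρ g⁻¹ (n - b)
  left_inv n := by
    dsimp only
    rw [add_sub_cancel_left, ← Module.End.mul_apply, ← map_mul, inv_mul_cancel, map_one]
    rfl
  right_inv n := by
    dsimp only
    rw [← Module.End.mul_apply, ← map_mul, mul_inv_cancel, map_one]
    exact add_sub_cancel b n

theorem affinePerm_apply (ρ : Representation ℤ G N) (g : G) (b n : N) :
    affinePerm ρ g b n = b + ρ g n := rfl

theorem affinePerm_mul (ρ : Representation ℤ G N) (g h : G) (b c : N) :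
    affinePerm ρ g b * affinePerm ρ h c = affinePerm ρ (g * h) (b + ρ g c) := by
  ext n
  simp [affinePerm_apply, add_assoc]

theorem affinePerm_inv (ρ : Representation ℤ G N) (g : G) (b : N) :
    (affinePerm ρ g b)⁻¹ = affinePerm ρ g⁻¹ (-ρ g⁻¹ b) := by
  rw [inv_eq_iff_mul_eq_one, affinePerm_mul]
  ext n
  simp [affinePerm_apply, ← Module.End.mul_apply, ← map_mul]

variable {𝓟 : Set (Subgroup G)} {σ : Type u} (f : σ → G) (ρ : Representation ℤ G N)
  (e : σ ⊕ 𝓟 → N)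

/-- The affine action of the free product in which `s` acts by `n ↦ e_s + s n`, and each `P ∈ 𝓟`
acts with fixed point `-e_P`. -/
def foxHom : Monoid.Coprod (Monoid.CoprodI fun P : 𝓟 => P.1) (FreeGroup σ) →* Equiv.Perm N :=
  Monoid.Coprod.lift
    (Monoid.CoprodI.lift fun P : 𝓟 =>
      MonoidHom.mk' (fun p : P.1 => affinePerm ρ p.1 (ρ p.1 (e (.inr P)) - e (.inr P))) fun p q => by
        rw [affinePerm_mul]
        congr 1
        simp)
    (FreeGroup.lift fun s => affinePerm ρ (f s) (e (.inl s)))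

/-- The derivation with `s ↦ e_s` and `p ↦ p e_P - e_P` for `p ∈ P`. -/
def foxDer (x : Monoid.Coprod (Monoid.CoprodI fun P : 𝓟 => P.1) (FreeGroup σ)) : N :=
  foxHom f ρ e x 0

theorem foxHom_inl (P : 𝓟) (p : P.1) :
    foxHom f ρ e (.inl (Monoid.CoprodI.of (M := fun P : 𝓟 => P.1) p)) =
      affinePerm ρ p.1 (ρ p.1 (e (.inr P)) - e (.inr P)) := by
  simp [foxHom]

theorem foxHom_inr (s : σ) :
    foxHom f ρ e (.inr (.of s)) = affinePerm ρ (f s) (e (.inl s)) := by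
  simp [foxHom]

theorem foxHom_inr_inv (s : σ) :
    foxHom f ρ e (.inr (.of s)⁻¹) = affinePerm ρ (f s)⁻¹ (-ρ (f s)⁻¹ (e (.inl s))) := by
  rw [map_inv, map_inv, foxHom_inr, affinePerm_inv]

/-- Induction over the free product of the groups in `𝓟` and a free group. -/
theorem coprod_induction
    {motive : Monoid.Coprod (Monoid.CoprodI fun P : 𝓟 => P.1) (FreeGroup σ) → Prop}
    (one : motive 1)
    (inl : ∀ (P : 𝓟) (p : P.1), motive (.inl (Monoid.CoprodI.of (M := fun P : 𝓟 => P.1) p)))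
    (inr : ∀ s, motive (.inr (.of s))) (inr_inv : ∀ s, motive (.inr (.of s)⁻¹))
    (mul : ∀ x y, motive x → motive y → motive (x * y)) (x) : motive x := by
  induction x using Monoid.Coprod.induction_on with
  | inl x =>
    induction x using Monoid.CoprodI.induction_on with
    | one => simpa using one
    | of P p => exact inl P p
    | mul x y hx hy => simpa using mul _ _ hx hy
  | inr x =>
    induction x using FreeGroup.induction_on with
    | C1 => simpa using one
    | of s => exact inr s
    | inv_of s _ => exact inr_inv s
    | mul x y hx hy => simpa using mul _ _ hx hy
  | mul x y hx hy => exact mul _ _ hx hy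

theorem coprodHom_inl (P : 𝓟) (p : P.1) :
    coprodHom 𝓟 (FreeGroup.lift f) (.inl (Monoid.CoprodI.of (M := fun P : 𝓟 => P.1) p)) = p.1 := by
  simp [coprodHom]

theorem coprodHom_inr (s : σ) : coprodHom 𝓟 (FreeGroup.lift f) (.inr (.of s)) = f s := by
  simp [coprodHom]

theorem coprodHom_inr_inv (s : σ) :
    coprodHom 𝓟 (FreeGroup.lift f) (.inr (.of s)⁻¹) = (f s)⁻¹ := by
  simp [coprodHom]

/-- Each element acts by an affine map whose linear part is its image in `G` and whose translation
part is the derivation; composing affine maps then gives the Leibniz rule. -/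
theorem foxHom_apply (x) (n : N) :
    foxHom f ρ e x n = foxDer f ρ e x + ρ (coprodHom 𝓟 (FreeGroup.lift f) x) n := by
  induction x using coprod_induction generalizing n with
  | one => simp [foxDer]
  | inl P p => rw [foxDer, foxHom_inl, coprodHom_inl]; simp [affinePerm_apply]
  | inr s => rw [foxDer, foxHom_inr, coprodHom_inr]; simp [affinePerm_apply]
  | inr_inv s => rw [foxDer, foxHom_inr_inv, coprodHom_inr_inv]; simp [affinePerm_apply]
  | mul x y hx hy =>
    have h : foxDer f ρ e (x * y) =
        foxDer f ρ e x + ρ (coprodHom 𝓟 (FreeGroup.lift f) x) (foxDer f ρ e y) := by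
      rw [← hx, foxDer, map_mul, Equiv.Perm.mul_apply]
      rfl
    rw [h, map_mul, Equiv.Perm.mul_apply, hy, hx, map_mul, map_mul, map_add,
      Module.End.mul_apply, add_assoc]

theorem foxDer_mul (x y) :
    foxDer f ρ e (x * y) =
      foxDer f ρ e x + ρ (coprodHom 𝓟 (FreeGroup.lift f) x) (foxDer f ρ e y) := by
  rw [← foxHom_apply, foxDer, map_mul, Equiv.Perm.mul_apply]
  rfl

theorem foxDer_inl (P : 𝓟) (p : P.1) :
    foxDer f ρ e (.inl (Monoid.CoprodI.of (M := fun P : 𝓟 => P.1) p)) =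
      ρ p.1 (e (.inr P)) - e (.inr P) := by
  simp [foxDer, foxHom_inl, affinePerm_apply]

theorem foxDer_inr (s : σ) : foxDer f ρ e (.inr (.of s)) = e (.inl s) := by
  simp [foxDer, foxHom_inr, affinePerm_apply]

theorem foxDer_inr_inv (s : σ) :
    foxDer f ρ e (.inr (.of s)⁻¹) = -ρ (f s)⁻¹ (e (.inl s)) := by
  rw [foxDer, foxHom_inr_inv]
  simp [affinePerm_apply]

theorem foxDer_one : foxDer (𝓟 := 𝓟) f ρ e 1 = 0 := by simp [foxDer]

/-- A derivation is determined by its values on generators; this is used to pass to the quotient by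
boundaries of 2-cells. -/
theorem map_foxDer {N' : Type u} [AddCommGroup N'] (ρ' : Representation ℤ G N') (q : N →ₗ[ℤ] N')
    (hq : ∀ g n, q (ρ g n) = ρ' g (q n)) (x) :
    q (foxDer f ρ e x) = foxDer f ρ' (q ∘ e) x := by
  induction x using coprod_induction with
  | one => simp [foxDer_one]
  | inl P p => simp only [foxDer_inl, map_sub, hq, Function.comp_apply]
  | inr s => simp only [foxDer_inr, Function.comp_apply]
  | inr_inv s => simp only [foxDer_inr_inv, map_neg, hq, Function.comp_apply]
  | mul x y hx hy => simp only [foxDer_mul, map_add, hq, hx, hy]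

/-- If the derivation vanishes on relators, it descends to `G`. -/
theorem exists_derivation {R : Set (Monoid.Coprod (Monoid.CoprodI fun P : 𝓟 => P.1) (FreeGroup σ))}
    (hsurj : Function.Surjective (coprodHom 𝓟 (FreeGroup.lift f)))
    (hker : Subgroup.normalClosure R = (coprodHom 𝓟 (FreeGroup.lift f)).ker)
    (hR : ∀ r ∈ R, foxDer f ρ e r = 0) :
    ∃ δ : G → N, (∀ g h, δ (g * h) = δ g + ρ g (δ h)) ∧ (∀ s, δ (f s) = e (.inl s)) ∧
      ∀ (P : 𝓟) (p : P.1), δ p.1 = ρ p.1 (e (.inr P)) - e (.inr P) := by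
  -- A relator has trivial linear part and zero translation part, so it acts as the identity, and so
  -- does the whole kernel.
  have hle : (coprodHom 𝓟 (FreeGroup.lift f)).ker ≤ (foxHom f ρ e).ker := by
    rw [← hker]
    refine Subgroup.normalClosure_le_normal fun r hr => ?_
    have hr' : coprodHom 𝓟 (FreeGroup.lift f) r = 1 := by
      rw [← MonoidHom.mem_ker, ← hker]
      exact Subgroup.subset_normalClosure hr
    refine Equiv.ext fun n => ?_
    rw [foxHom_apply, hR r hr, hr', map_one, zero_add]
    rfl
  have hwd : ∀ x y, coprodHom 𝓟 (FreeGroup.lift f) x = coprodHom 𝓟 (FreeGroup.lift f) y →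
      foxDer f ρ e x = foxDer f ρ e y := by
    intro x y hxy
    have h1 : x⁻¹ * y ∈ (coprodHom 𝓟 (FreeGroup.lift f)).ker := by
      rw [MonoidHom.mem_ker, map_mul, map_inv, hxy, inv_mul_cancel]
    have h2 : foxHom f ρ e (x⁻¹ * y) = 1 := hle h1
    rw [map_mul, map_inv, inv_mul_eq_one] at h2
    rw [foxDer, h2, foxDer]
  choose w hw using hsurj
  refine ⟨fun g => foxDer f ρ e (w g), fun g h => ?_, fun s => ?_, fun P p => ?_⟩
  · dsimp only
    rw [hwd (w (g * h)) (w g * w h) (by rw [map_mul, hw, hw, hw]), foxDer_mul, hw]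
  · dsimp only
    rw [hwd _ (.inr (.of s)) (by rw [hw, coprodHom_inr]), foxDer_inr]
  · dsimp only
    rw [hwd _ (.inl (Monoid.CoprodI.of (M := fun P : 𝓟 => P.1) p)) (by rw [hw, coprodHom_inl]),
      foxDer_inl]

end Affine

/-- The free `G`-set with orbits indexed by `I`. -/
structure FreeCell (G I : Type u) : Type u where
  elt : G
  idx : I

instance (I : Type u) : MulAction G (FreeCell G I) where
  smul g c := ⟨g * c.elt, c.idx⟩
  one_smul c := congrArg (FreeCell.mk · c.idx) (one_mul c.elt)
  mul_smul a b c := congrArg (FreeCell.mk · c.idx) (mul_assoc a b c.elt)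

theorem FreeCell.smul_mk {I : Type u} (g h : G) (i : I) :
    g • (⟨h, i⟩ : FreeCell G I) = ⟨g * h, i⟩ := rfl

theorem FreeCell.eq_one_of_smul_eq {I : Type u} {g : G} {c : FreeCell G I} (h : g • c = c) :
    g = 1 :=
  mul_eq_right.mp (congrArg FreeCell.elt h)

theorem FreeCell.stabilizer_eq_bot {I : Type u} (c : FreeCell G I) :
    MulAction.stabilizer G c = ⊥ :=
  (Subgroup.eq_bot_iff_forall _).mpr fun _ hg => eq_one_of_smul_eq hg

theorem FreeCell.finite_orbits {I : Type u} [Finite I] :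
    Finite (MulAction.orbitRel.Quotient G (FreeCell G I)) :=
  finite_orbits_of_surjective (FreeCell.mk 1)
    fun c => ⟨c.idx, c.elt, congrArg (FreeCell.mk · c.idx) (mul_one c.elt)⟩

/-- The permutation representation on `ℤ[T]`. -/
noncomputable def permRep (T : Type u) [MulAction G T] : Representation ℤ G (T →₀ ℤ) where
  toFun g := Finsupp.lmapDomain ℤ ℤ (g • ·)
  map_one' := by
    ext t : 2
    simp
  map_mul' g h := by
    ext t : 2
    simp [mul_smul]

theorem permRep_single {T : Type u} [MulAction G T] (g : G) (t : T) (n : ℤ) :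
    permRep T g (Finsupp.single t n) = Finsupp.single (g • t) n :=
  Finsupp.mapDomain_single

theorem linearCombination_permRep {T N : Type u} [MulAction G T] [AddCommGroup N]
    (ρ : Representation ℤ G N) (v : T → N) (hv : ∀ (g : G) t, v (g • t) = ρ g (v t)) (g : G)
    (x : T →₀ ℤ) : Finsupp.linearCombination ℤ v (permRep T g x) =
      ρ g (Finsupp.linearCombination ℤ v x) := by
  suffices h : Finsupp.linearCombination ℤ v ∘ₗ permRep T g = ρ g ∘ₗ Finsupp.linearCombination ℤ v from
    LinearMap.congr_fun h x
  ext t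
  simp [permRep_single, hv]

/-! ### The cellular chain complex and its exactness -/

section Complex

variable {𝓟 : Set (Subgroup G)} {σ : Type u} (f : σ → G)

/-- Boundary of an oriented edge of the coned-off Cayley graph. -/
noncomputable def edgeBoundaryVec : FreeCell G (σ ⊕ 𝓟) → (ConedVertex 𝓟 →₀ ℤ)
  | ⟨g, .inl s⟩ => Finsupp.single (.elem (g * f s)) 1 - Finsupp.single (.elem g) 1
  | ⟨g, .inr P⟩ => Finsupp.single (.elem g) 1 - Finsupp.single (.cone P (QuotientGroup.mk g)) 1

/-- The cellular boundary map from edges to vertices. -/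
noncomputable def edgeBoundary : (FreeCell G (σ ⊕ 𝓟) →₀ ℤ) →ₗ[ℤ] (ConedVertex 𝓟 →₀ ℤ) :=
  Finsupp.linearCombination ℤ (edgeBoundaryVec f)

theorem edgeBoundary_permRep (g : G) (x : FreeCell G (σ ⊕ 𝓟) →₀ ℤ) :
    edgeBoundary f (permRep _ g x) = permRep _ g (edgeBoundary f x) := by
  refine linearCombination_permRep _ _ ?_ g x
  rintro g ⟨h, s | P⟩
  · simp only [FreeCell.smul_mk, edgeBoundaryVec, map_sub, permRep_single, ConedVertex.smul_elem,
      mul_assoc]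
  · simp only [FreeCell.smul_mk, edgeBoundaryVec, map_sub, permRep_single, ConedVertex.smul_elem,
      ConedVertex.smul_cone]

/-- The basic edges. -/
noncomputable def edgeBasis (i : σ ⊕ 𝓟) : FreeCell G (σ ⊕ 𝓟) →₀ ℤ := Finsupp.single ⟨1, i⟩ 1

theorem edgeBoundary_edgeBasis_inl (s : σ) : edgeBoundary f (edgeBasis (𝓟 := 𝓟) (.inl s)) =
    Finsupp.single (.elem (f s)) 1 - Finsupp.single (.elem 1) 1 := by
  simp [edgeBoundary, edgeBasis, edgeBoundaryVec]

theorem edgeBoundary_edgeBasis_inr (P : 𝓟) : edgeBoundary f (edgeBasis (.inr P)) =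
    Finsupp.single (.elem 1) 1 - Finsupp.single (.cone P (QuotientGroup.mk 1)) 1 := by
  simp [edgeBoundary, edgeBasis, edgeBoundaryVec]

/-- The fundamental formula of the Fox calculus. -/
theorem edgeBoundary_foxDer (x) :
    edgeBoundary f (foxDer f (permRep _) (edgeBasis (𝓟 := 𝓟)) x) =
      Finsupp.single (.elem (coprodHom 𝓟 (FreeGroup.lift f) x)) 1 - Finsupp.single (.elem 1) 1 := by
  induction x using coprod_induction with
  | one => simp [foxDer_one]
  | inl P p =>
    -- The elements `p` and `1` share a cone-vertex, so the cone terms cancel.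
    have hp : (QuotientGroup.mk p.1 : G ⧸ P.1) = QuotientGroup.mk 1 := by
      rw [eq_comm, QuotientGroup.eq]
      simp
    rw [foxDer_inl, coprodHom_inl, map_sub, edgeBoundary_permRep, edgeBoundary_edgeBasis_inr]
    simp [permRep_single, ConedVertex.smul_elem, ConedVertex.smul_cone, hp]
  | inr s => rw [foxDer_inr, coprodHom_inr, edgeBoundary_edgeBasis_inl]
  | inr_inv s =>
    rw [foxDer_inr_inv, coprodHom_inr_inv, map_neg, edgeBoundary_permRep,
      edgeBoundary_edgeBasis_inl]
    simp [permRep_single, ConedVertex.smul_elem]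
  | mul x y hx hy =>
    rw [foxDer_mul, map_add, edgeBoundary_permRep, hx, hy]
    simp [permRep_single, ConedVertex.smul_elem]

variable (R : Set (Monoid.Coprod (Monoid.CoprodI fun P : 𝓟 => P.1) (FreeGroup σ)))

/-- The cellular boundary map from 2-cells to edges. -/
noncomputable def cellBoundary : (FreeCell G R →₀ ℤ) →ₗ[ℤ] (FreeCell G (σ ⊕ 𝓟) →₀ ℤ) :=
  Finsupp.linearCombination ℤ fun c =>
    permRep _ c.elt (foxDer f (permRep _) (edgeBasis (𝓟 := 𝓟)) c.idx.1)

theorem cellBoundary_permRep (g : G) (x : FreeCell G R →₀ ℤ) :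
    cellBoundary f R (permRep _ g x) = permRep _ g (cellBoundary f R x) := by
  refine linearCombination_permRep _ _ ?_ g x
  rintro g ⟨h, r⟩
  simp only [FreeCell.smul_mk, map_mul, Module.End.mul_apply]

variable {R}

/-- By the fundamental formula, the boundary of the derivative of `r` is the image of `r` minus the
identity vertex, which is zero for a relator. -/
theorem edgeBoundary_cellBoundary (hR : ∀ r ∈ R, coprodHom 𝓟 (FreeGroup.lift f) r = 1)
    (x : FreeCell G R →₀ ℤ) : edgeBoundary f (cellBoundary f R x) = 0 := by
  suffices h : edgeBoundary f ∘ₗ cellBoundary f R = 0 from LinearMap.congr_fun h x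
  ext1 c
  ext1
  simp [cellBoundary, edgeBoundary_permRep, edgeBoundary_foxDer, hR _ c.idx.2]

/-- Modulo the image `B` of the 2-cells, the Fox derivation kills relators and descends to `δ` on
`G`. It defines a map from `ℤ[V]` whose composite with the edge boundary is the quotient map by `B`,
so cycles lie in `B`. -/
theorem exists_cellBoundary_eq
    (hsurj : Function.Surjective (coprodHom 𝓟 (FreeGroup.lift f)))
    (hker : Subgroup.normalClosure R = (coprodHom 𝓟 (FreeGroup.lift f)).ker)
    (x : FreeCell G (σ ⊕ 𝓟) →₀ ℤ) (hx : edgeBoundary f x = 0) : ∃ y, cellBoundary f R y = x := by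
  let B := LinearMap.range (cellBoundary f R)
  have hB : ∀ g : G, B ≤ B.comap (permRep _ g) := by
    rintro g _ ⟨y, rfl⟩
    exact ⟨permRep _ g y, cellBoundary_permRep f R g y⟩
  let ρ : Representation ℤ G ((FreeCell G (σ ⊕ 𝓟) →₀ ℤ) ⧸ B) :=
    { toFun := fun g => B.mapQ B (permRep _ g) (hB g)
      map_one' := by
        ext
        simp
      map_mul' := fun g h => by
        ext1
        ext1
        ext1
        simp }
  have hρ : ∀ g n, B.mkQ (permRep _ g n) = ρ g (B.mkQ n) := fun g n => rfl
  obtain ⟨δ, hδ, hδs, hδP⟩ := exists_derivation f ρ (B.mkQ ∘ edgeBasis) hsurj hker fun r hr => by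
    rw [← map_foxDer f (permRep _) edgeBasis ρ B.mkQ hρ, Submodule.mkQ_apply,
      Submodule.Quotient.mk_eq_zero]
    exact ⟨Finsupp.single ⟨1, ⟨r, hr⟩⟩ 1, by simp [cellBoundary]⟩
  have hbasis : ∀ g i, ρ g (B.mkQ (edgeBasis i)) = B.mkQ (Finsupp.single ⟨g, i⟩ 1) := by
    intro g i
    rw [← hρ, edgeBasis, permRep_single, FreeCell.smul_mk, mul_one]
  -- The value at a cone-vertex is forced by the cone edge at `g`, whose boundary is `g - v(gP)`.
  -- Independence of the representative is the formula for `δ` on `P` combined with the Leibniz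
  -- rule.
  let hV : ConedVertex 𝓟 → (FreeCell G (σ ⊕ 𝓟) →₀ ℤ) ⧸ B
    | .elem g => δ g
    | .cone P x => Quotient.liftOn' x (fun g => δ g - ρ g (B.mkQ (edgeBasis (.inr P)))) fun a b hab => by
        have hp : a⁻¹ * b ∈ P.1 := QuotientGroup.leftRel_apply.mp hab
        have hb : b = a * (a⁻¹ * b) := by group
        have h1 := hδP P ⟨_, hp⟩
        have h2 := hδ a (a⁻¹ * b)
        dsimp only at h1
        rw [← hb, h1, map_sub, ← Module.End.mul_apply, ← map_mul, ← hb] at h2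
        rw [h2]
        simp only [Function.comp_apply]
        abel
  have hV_cone : ∀ (P : 𝓟) (g : G),
      hV (.cone P (QuotientGroup.mk g)) = δ g - ρ g (B.mkQ (edgeBasis (.inr P))) := fun _ _ => rfl
  have hV_elem : ∀ g : G, hV (.elem g) = δ g := fun _ => rfl
  have key : Finsupp.linearCombination ℤ hV ∘ₗ edgeBoundary f = B.mkQ := by
    ext1 c
    ext1
    obtain ⟨g, s | P⟩ := c
    · simp only [LinearMap.comp_apply, Finsupp.lsingle_apply, edgeBoundary, edgeBoundaryVec,
        Finsupp.linearCombination_single, map_sub, one_smul, hV_elem, hδ, hδs,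
        Function.comp_apply, hbasis, add_sub_cancel_left]
    · simp only [LinearMap.comp_apply, Finsupp.lsingle_apply, edgeBoundary, edgeBoundaryVec,
        Finsupp.linearCombination_single, map_sub, one_smul, hV_elem, hV_cone, hbasis, sub_sub_cancel]
  have h := LinearMap.congr_fun key x
  rw [LinearMap.comp_apply, hx, map_zero] at h
  exact (Submodule.Quotient.mk_eq_zero B).mp h.symm

/-- The augmentation `ℤ[V] → ℤ[G/G]`. -/
noncomputable def vertexAug : (ConedVertex 𝓟 →₀ ℤ) →ₗ[ℤ] (G ⧸ (⊤ : Subgroup G) →₀ ℤ) :=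
  Finsupp.lmapDomain ℤ ℤ fun _ => QuotientGroup.mk 1

theorem vertexAug_single (v : ConedVertex 𝓟) (n : ℤ) :
    vertexAug (Finsupp.single v n) = Finsupp.single (QuotientGroup.mk 1) n :=
  Finsupp.mapDomain_single

theorem vertexAug_permRep (g : G) (x : ConedVertex 𝓟 →₀ ℤ) :
    vertexAug (permRep _ g x) = permRep _ g (vertexAug x) := by
  suffices h : vertexAug ∘ₗ permRep (ConedVertex 𝓟) g = permRep _ g ∘ₗ vertexAug from
    LinearMap.congr_fun h x
  ext1 v
  ext1
  simp only [LinearMap.comp_apply, Finsupp.lsingle_apply, permRep_single, vertexAug_single]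
  congr 1
  exact QuotientGroup.subsingleton_quotient_top.elim _ _

theorem vertexAug_edgeBoundary (x : FreeCell G (σ ⊕ 𝓟) →₀ ℤ) :
    vertexAug (edgeBoundary f x) = 0 := by
  suffices h : vertexAug ∘ₗ edgeBoundary (𝓟 := 𝓟) f = 0 from LinearMap.congr_fun h x
  ext1 c
  ext1
  obtain ⟨g, s | P⟩ := c <;>
  simp [edgeBoundary, edgeBoundaryVec, vertexAug_single]

/-- Modulo boundaries of edges all vertices become equal, because the generators and the groups in
`𝓟` together generate `G`. Hence the quotient map factors through the augmentation. -/
theorem exists_edgeBoundary_eq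
    (hsurj : Function.Surjective (coprodHom 𝓟 (FreeGroup.lift f)))
    (x : ConedVertex 𝓟 →₀ ℤ) (hx : vertexAug x = 0) : ∃ y, edgeBoundary f y = x := by
  let B := LinearMap.range (edgeBoundary (𝓟 := 𝓟) f)
  let q : ConedVertex 𝓟 → (ConedVertex 𝓟 →₀ ℤ) ⧸ B := fun v => B.mkQ (Finsupp.single v 1)
  have hs : ∀ g s, q (.elem (g * f s)) = q (.elem g) := fun g s => by
    refine (Submodule.Quotient.eq B).mpr ⟨Finsupp.single ⟨g, .inl s⟩ 1, ?_⟩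
    simp [edgeBoundary, edgeBoundaryVec]
  have hP : ∀ (g : G) (P : 𝓟), q (.elem g) = q (.cone P (QuotientGroup.mk g)) := fun g P => by
    refine (Submodule.Quotient.eq B).mpr ⟨Finsupp.single ⟨g, .inr P⟩ 1, ?_⟩
    simp [edgeBoundary, edgeBoundaryVec]
  have hmul : ∀ x g, q (.elem (g * coprodHom 𝓟 (FreeGroup.lift f) x)) = q (.elem g) := by
    intro x
    induction x using coprod_induction with
    | one => simp
    | inl P p =>
      intro g
      rw [coprodHom_inl, hP _ P, hP _ P, QuotientGroup.mk_mul_of_mem g p.2]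
    | inr s =>
      intro g
      rw [coprodHom_inr, hs]
    | inr_inv s =>
      intro g
      rw [coprodHom_inr_inv, ← hs _ s, inv_mul_cancel_right]
    | mul x y hx hy =>
      intro g
      rw [map_mul, ← mul_assoc, hy, hx]
  have helem : ∀ g, q (.elem g) = q (.elem 1) := fun g => by
    obtain ⟨x, rfl⟩ := hsurj g
    simpa using hmul x 1
  have hall : ∀ v, q v = q (.elem 1) := by
    rintro (g | ⟨P, x⟩)
    · exact helem g
    · induction x using QuotientGroup.induction_on with
      | H g => rw [← hP, helem]
  have key : Finsupp.linearCombination ℤ (fun _ => q (.elem 1)) ∘ₗ vertexAug = B.mkQ := by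
    ext1 v
    ext1
    simp only [LinearMap.comp_apply, Finsupp.lsingle_apply, vertexAug_single,
      Finsupp.linearCombination_single, one_smul]
    exact (hall v).symm
  have h := LinearMap.congr_fun key x
  rw [LinearMap.comp_apply, hx, map_zero] at h
  exact (Submodule.Quotient.mk_eq_zero B).mp h.symm

end Complex

end Fox

/-! ### Projective modules over the orbit category -/

section OrbitModules

open CategoryTheory Opposite

variable {G : Type u} [Group G] {F : Set (Subgroup G)}

/-- The `G`-map `G/A → G/B` with `A ↦ y`, for a coset `y` fixed by `A`. -/
def OrbitCat.homOfFixed {A B : OrbitCat F} (y : FixedPts (G ⧸ B.H) A.H) : A ⟶ B :=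
  ({ toFun := fun x => cosetSMul x y
     map_smul' := fun g x => cosetSMul_smul g x y } : (G ⧸ A.H) →[G] (G ⧸ B.H))

/-- The `G`-map underlying a morphism of the orbit category. -/
def OrbitCat.toMap {A B : OrbitCat F} (φ : A ⟶ B) : (G ⧸ A.H) →[G] (G ⧸ B.H) := φ

/-- The coset that determines a morphism of the orbit category. -/
def OrbitCat.coset {A B : OrbitCat F} (φ : A ⟶ B) : G ⧸ B.H :=
  OrbitCat.toMap φ (QuotientGroup.mk 1)

theorem OrbitCat.coset_homOfFixed {A B : OrbitCat F} (y : FixedPts (G ⧸ B.H) A.H) :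
    OrbitCat.coset (OrbitCat.homOfFixed y) = y.1 :=
  one_smul G y.1

theorem OrbitCat.hom_ext {A B : OrbitCat F} {φ ψ : A ⟶ B}
    (h : OrbitCat.coset φ = OrbitCat.coset ψ) : φ = ψ := by
  refine MulActionHom.ext (f := OrbitCat.toMap φ) (g := OrbitCat.toMap ψ) fun x => ?_
  induction x using QuotientGroup.induction_on with
  | H g =>
    have hg : (QuotientGroup.mk g : G ⧸ A.H) = g • QuotientGroup.mk 1 :=
      congrArg QuotientGroup.mk (mul_one g).symm
    rw [hg]
    refine (map_smul (OrbitCat.toMap φ) g _).trans ?_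
    refine Eq.trans ?_ (map_smul (OrbitCat.toMap ψ) g _).symm
    exact congrArg (g • ·) h

theorem OrbitCat.coset_comp {A B C : OrbitCat F} (φ : A ⟶ B) (ψ : B ⟶ C) {g : G}
    (hg : OrbitCat.coset φ = QuotientGroup.mk g) :
    OrbitCat.coset (φ ≫ ψ) = g • OrbitCat.coset ψ := by
  have h1 : OrbitCat.coset (φ ≫ ψ) = OrbitCat.toMap ψ (OrbitCat.coset φ) := rfl
  have h2 : (QuotientGroup.mk g : G ⧸ B.H) = g • QuotientGroup.mk 1 :=
    congrArg QuotientGroup.mk (mul_one g).symm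
  rw [h1, hg, h2]
  exact map_smul (OrbitCat.toMap ψ) g _

theorem fixedPtsMap_val {T : Type u} [MulAction G T] {A B : OrbitCat F} (φ : A ⟶ B) {g : G}
    (hg : OrbitCat.coset φ = QuotientGroup.mk g) (t : FixedPts T B.H) :
    (fixedPtsMap T φ t).1 = g • t.1 := by
  change cosetSMul (OrbitCat.coset φ) t = _
  rw [hg, cosetSMul_mk]

/-! ### Morphisms out of induced modules -/

section Desc

variable {T : Type u} [MulAction G T] {M : OrbitModule F}

/-- The basis element of `ℤ[T^K]` given by a point of `T^K`. -/
noncomputable def inducedBasis {K : OrbitCat F} (t : FixedPts T K.H) :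
    (inducedModule F T).obj (op K) :=
  Finsupp.single (M := ℤ) t 1

/-- The morphism `ℤ[·, T] ⟶ M` induced by compatible maps `T^K → M(G/K)`. -/
noncomputable def inducedDesc (η : ∀ K : OrbitCat F, FixedPts T K.H → M.obj (op K))
    (hη : ∀ {L K : OrbitCat F} (φ : L ⟶ K) (t : FixedPts T K.H),
      M.map φ.op (η K t) = η L (fixedPtsMap T φ t)) : inducedModule F T ⟶ M where
  app K := ModuleCat.ofHom (Finsupp.linearCombination ℤ (η K.unop))
  naturality K L φ := by
    refine ModuleCat.hom_ext (Finsupp.lhom_ext' fun t => LinearMap.ext_ring ?_)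
    have h (A : OrbitCat F) (t : FixedPts T A.H) :
        Finsupp.linearCombination ℤ (η A) (Finsupp.single t 1) = η A t :=
      (Finsupp.linearCombination_single ℤ 1 t).trans
        ((M.obj (op A)).isModule.toMulAction.one_smul _)
    have h1 : (Finsupp.lmapDomain ℤ ℤ (fixedPtsMap T φ.unop)) (Finsupp.single t 1) =
      Finsupp.single (fixedPtsMap T φ.unop t) 1 := Finsupp.mapDomain_single
    refine (congrArg (Finsupp.linearCombination ℤ (η L.unop)) h1).trans ((h _ _).trans ?_)
    exact (hη φ.unop t).symm.trans (congrArg (M.map φ) (h K.unop t).symm)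

theorem inducedDesc_app_single (η : ∀ K : OrbitCat F, FixedPts T K.H → M.obj (op K)) (hη)
    (K : OrbitCat F) (t : FixedPts T K.H) :
    (inducedDesc η hη).app (op K) (inducedBasis t) = η K t :=
  (Finsupp.linearCombination_single ℤ 1 t).trans ((M.obj (op K)).isModule.toMulAction.one_smul _)

theorem inducedModule_hom_ext {f g : inducedModule F T ⟶ M}
    (h : ∀ (K : OrbitCat F) (t : FixedPts T K.H),
      f.app (op K) (inducedBasis t) = g.app (op K) (inducedBasis t)) : f = g := by
  refine NatTrans.ext (funext fun K => ?_)
  exact ModuleCat.hom_ext (Finsupp.lhom_ext' fun t => LinearMap.ext_ring (h K.unop t))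

theorem inducedModule_map_single {A B : OrbitCat F} (φ : A ⟶ B) (t : FixedPts T B.H) :
    (inducedModule F T).map φ.op (inducedBasis t) =
      inducedBasis (fixedPtsMap T φ t) :=
  Finsupp.mapDomain_single

end Desc

theorem orbitModule_epi_iff {M N : OrbitModule F} (e : M ⟶ N) :
    Epi e ↔ ∀ K : OrbitCat F, Function.Surjective (e.app (op K)) := by
  rw [NatTrans.epi_iff_epi_app]
  exact ⟨fun h K => (ModuleCat.epi_iff_surjective _).mp (h (op K)),
    fun h K => (ModuleCat.epi_iff_surjective _).mpr (h K.unop)⟩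

/-- A `G`-set with isotropy in `F` induces a projective module. -/
theorem projective_inducedModule {T : Type u} [MulAction G T]
    (hT : ∀ t : T, MulAction.stabilizer G t ∈ F) : Projective (inducedModule F T) where
  factors {E X} f e he := by
    -- A Yoneda argument: with one representative `r i` per orbit, `ℤ[·, T]` is a sum of
    -- representables at the stabilizers, so a morphism out of it is a free choice of one element
    -- for each orbit.
    let r : MulAction.orbitRel.Quotient G T → T := Quotient.out
    let H : MulAction.orbitRel.Quotient G T → OrbitCat F :=
      fun i => ⟨MulAction.stabilizer G (r i), hT _⟩
    let b : ∀ i, FixedPts T (H i).H := fun i => ⟨r i, fun _ h => h⟩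
    have hsurj := (orbitModule_epi_iff e).mp he
    choose m hm using fun i => hsurj (H i) (f.app (op (H i)) (inducedBasis (b i)))
    -- Writing `t = g⁻¹ • r i`, the coset of `g⁻¹` is fixed by `K` because `t` is, and it gives the
    -- required morphism.
    have hex : ∀ (K : OrbitCat F) (t : FixedPts T K.H),
        ∃ i, ∃ φ : K ⟶ H i, fixedPtsMap T φ (b i) = t := by
      intro K t
      let i : MulAction.orbitRel.Quotient G T := Quotient.mk _ t.1
      obtain ⟨g, hg⟩ : r i ∈ MulAction.orbit G t.1 :=
        MulAction.orbitRel_apply.mp (Quotient.exact (Quotient.out_eq i))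
      have hg : g⁻¹ • r i = t.1 := by
        rw [← hg]
        exact inv_smul_smul g t.1
      let y : FixedPts (G ⧸ (H i).H) K.H := ⟨QuotientGroup.mk g⁻¹, fun k hk => by
        refine QuotientGroup.eq.mpr ?_
        change ((k * g⁻¹)⁻¹ * g⁻¹) • r i = r i
        rw [mul_smul, hg, inv_smul_eq_iff, mul_smul, hg, t.2 k hk]⟩
      refine ⟨i, OrbitCat.homOfFixed y, Subtype.ext ?_⟩
      rw [fixedPtsMap_val _ (OrbitCat.coset_homOfFixed y)]
      exact hg
    -- The orbit and the morphism are determined by the point, so the chosen lifts are compatible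
    -- with restriction.
    have huniq : ∀ (K : OrbitCat F) (i j) (φ : K ⟶ H i) (ψ : K ⟶ H j),
        fixedPtsMap T φ (b i) = fixedPtsMap T ψ (b j) →
          E.map φ.op (m i) = E.map ψ.op (m j) := by
      intro K i j φ ψ h
      obtain ⟨g, hg⟩ := QuotientGroup.mk_surjective (OrbitCat.coset φ)
      obtain ⟨k, hk⟩ := QuotientGroup.mk_surjective (OrbitCat.coset ψ)
      have h1 : g • r i = k • r j := by
        rw [← fixedPtsMap_val φ hg.symm (b i), h, fixedPtsMap_val ψ hk.symm (b j)]
      have hij : i = j := by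
        rw [← Quotient.out_eq i, ← Quotient.out_eq j]
        refine Quotient.sound (MulAction.orbitRel_apply.mpr ⟨g⁻¹ * k, ?_⟩)
        change (g⁻¹ * k) • r j = r i
        rw [mul_smul, ← h1, inv_smul_smul]
      subst hij
      have hφ : φ = ψ := by
        refine OrbitCat.hom_ext ?_
        rw [← hg, ← hk]
        refine QuotientGroup.eq.mpr ?_
        change (g⁻¹ * k) • r i = r i
        rw [mul_smul, ← h1, inv_smul_smul]
      rw [hφ]
    choose i φ hφ using hex
    refine ⟨inducedDesc (fun K t => E.map (φ K t).op (m (i K t))) ?_, ?_⟩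
    · intro L K ψ t
      have h1 : E.map ψ.op (E.map (φ K t).op (m (i K t))) =
          E.map (ψ ≫ φ K t).op (m (i K t)) := by
        rw [op_comp, E.map_comp]
        rfl
      rw [h1]
      apply huniq
      rw [hφ]
      refine Subtype.ext ?_
      refine (cosetSMul_comp T (H := L.H) (K := K.H) ψ (φ K t) (b _)).trans ?_
      rw [hφ]
      rfl
    · refine inducedModule_hom_ext fun K t => ?_
      change e.app (op K) ((inducedDesc _ _).app (op K) (inducedBasis t)) = _
      rw [inducedDesc_app_single]
      have h1 := NatTrans.naturality_apply e (φ K t).op (m (i K t))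
      have h2 := NatTrans.naturality_apply f (φ K t).op (inducedBasis (b (i K t)))
      rw [h1, hm, ← h2, inducedModule_map_single, hφ]

/-- The `G`-set of all elements of a module, spread over orbits. -/
structure ElementCell (M : OrbitModule F) : Type u where
  obj : OrbitCat F
  val : M.obj (op obj)
  coset : G ⧸ obj.H

instance (M : OrbitModule F) : MulAction G (ElementCell M) where
  smul g c := ⟨c.obj, c.val, g • c.coset⟩
  one_smul c := congrArg (ElementCell.mk c.obj c.val) (one_smul G c.coset)
  mul_smul a b c := congrArg (ElementCell.mk c.obj c.val) (mul_smul a b c.coset)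

theorem ElementCell.smul_mk {M : OrbitModule F} (g : G) (A : OrbitCat F) (m : M.obj (op A))
    (x : G ⧸ A.H) : g • (⟨A, m, x⟩ : ElementCell M) = ⟨A, m, g • x⟩ := rfl

theorem ElementCell.smul_coset_eq {M : OrbitModule F} {g : G} {c : ElementCell M} (h : g • c = c) :
    g • c.coset = c.coset := by
  obtain ⟨A, m, x⟩ := c
  rw [smul_mk, ElementCell.mk.injEq] at h
  exact eq_of_heq h.2.2

/-- Every module is covered by one orbit `G/H` for each element of each `M(G/H)`. The point `gH` has
stabilizer `gHg⁻¹`, hence the closure of `F` under conjugation. -/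
theorem enoughProjectives_orbitModule
    (hF : ∀ H ∈ F, ∀ g : G, H.map (MulAut.conj g).toMonoidHom ∈ F) :
    EnoughProjectives (OrbitModule F) where
  presentation M := by
    have hT : ∀ c : ElementCell M, MulAction.stabilizer G c ∈ F := by
      rintro ⟨A, m, x⟩
      induction x using QuotientGroup.induction_on with
      | H g =>
        have : MulAction.stabilizer G (⟨A, m, QuotientGroup.mk g⟩ : ElementCell M) =
            A.H.map (MulAut.conj g).toMonoidHom := by
          ext k
          have h1 : k ∈ MulAction.stabilizer G (⟨A, m, QuotientGroup.mk g⟩ : ElementCell M) ↔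
              (QuotientGroup.mk (k * g) : G ⧸ A.H) = QuotientGroup.mk g := by
            constructor
            · exact fun h => ElementCell.smul_coset_eq h
            · exact fun h => congrArg (ElementCell.mk A m) h
          rw [h1, eq_comm, QuotientGroup.eq, Subgroup.mem_map]
          constructor
          · intro h
            exact ⟨_, h, by simp [mul_assoc]⟩
          · rintro ⟨a, ha, rfl⟩
            simpa [mul_assoc] using ha
        rw [this]
        exact hF _ A.mem g
    let φ : ∀ (K : OrbitCat F) (c : FixedPts (ElementCell M) K.H), K ⟶ c.1.obj := fun K c =>
      OrbitCat.homOfFixed ⟨c.1.coset, fun k hk => ElementCell.smul_coset_eq (c.2 k hk)⟩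
    have hφ : ∀ K c, OrbitCat.coset (φ K c) = c.1.coset := fun K c =>
      OrbitCat.coset_homOfFixed _
    -- The cell is replaced by free variables `A`, `m`, `ψ` and an equation, since its fields depend
    -- on one another and cannot be rewritten separately.
    have hmap : ∀ (L : OrbitCat F) (c : FixedPts (ElementCell M) L.H) (A : OrbitCat F)
        (m : M.obj (op A)) (ψ : L ⟶ A), c.1 = ⟨A, m, OrbitCat.coset ψ⟩ →
          M.map (φ L c).op c.1.val = M.map ψ.op m := by
      rintro L ⟨c, hc⟩ A m ψ rfl
      have : φ L ⟨_, hc⟩ = ψ := OrbitCat.hom_ext (hφ L _)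
      rw [this]
    let π : inducedModule F (ElementCell M) ⟶ M :=
      inducedDesc (fun K c => M.map (φ K c).op c.1.val) fun {L K} ψ c => by
        have h1 : M.map ψ.op (M.map (φ K c).op c.1.val) = M.map (ψ ≫ φ K c).op c.1.val := by
          rw [op_comp, M.map_comp]
          rfl
        rw [h1]
        refine (hmap L (fixedPtsMap _ ψ c) _ _ (ψ ≫ φ K c) ?_).symm
        obtain ⟨g, hg⟩ := QuotientGroup.mk_surjective (OrbitCat.coset ψ)
        rw [fixedPtsMap_val ψ hg.symm, OrbitCat.coset_comp ψ _ hg.symm, hφ]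
        rfl
    refine ⟨{
      p := inducedModule F (ElementCell M)
      projective := projective_inducedModule hT
      f := π
      epi := (orbitModule_epi_iff π).mpr fun K m => ?_ }⟩
    refine ⟨inducedBasis ⟨⟨K, m, QuotientGroup.mk 1⟩, fun k hk => ?_⟩, ?_⟩
    · refine congrArg (ElementCell.mk K m) (QuotientGroup.eq.mpr ?_)
      simpa using hk
    · refine (inducedDesc_app_single _ _ K _).trans ((hmap K _ K m (𝟙 K) rfl).trans ?_)
      rw [op_id, M.map_id]
      rfl

end OrbitModules

/-! ### Resolutions with prescribed beginning -/

section Resolution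

open CategoryTheory CategoryTheory.Limits

/-- Evaluation commutes with homology, and a functor with zero values is zero. -/
theorem CategoryTheory.ShortComplex.exact_of_evaluation {J C : Type*} [Category* J] [Category* C]
    [Abelian C] (S : ShortComplex (J ⥤ C))
    (h : ∀ j, (S.map ((evaluation J C).obj j)).Exact) : S.Exact := by
  rw [S.exact_iff_isZero_homology]
  refine Functor.isZero _ fun j => ?_
  exact ((S.map _).exact_iff_isZero_homology.mp (h j)).of_iso
    (S.mapHomologyIso ((evaluation J C).obj j)).symm

variable {C : Type*} [Category* C] [Abelian C] [EnoughProjectives C]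

theorem projective_d_comp {X Y : C} (f : X ⟶ Y) : Projective.d f ≫ f = 0 :=
  (Category.assoc _ _ _).trans
    ((congrArg (Projective.π (kernel f) ≫ ·) (kernel.condition f)).trans comp_zero)

/-- The complex `⋯ → X₂ → X₁ → X₀` obtained by resolving the kernel of `X₂ → X₁`. -/
noncomputable def resolutionComplex {X₀ X₁ X₂ : C} (d₁ : X₁ ⟶ X₀) (d₂ : X₂ ⟶ X₁) (w : d₂ ≫ d₁ = 0) :
    ChainComplex C ℕ :=
  ChainComplex.mk X₀ X₁ X₂ d₁ d₂ w fun S => ⟨Projective.syzygies S.f, Projective.d S.f, projective_d_comp S.f⟩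

theorem resolutionComplex_exactAt_succ {X₀ X₁ X₂ : C} (d₁ : X₁ ⟶ X₀) (d₂ : X₂ ⟶ X₁)
    (w : d₂ ≫ d₁ = 0) (hex : (ShortComplex.mk d₂ d₁ w).Exact) (n : ℕ) :
    (resolutionComplex d₁ d₂ w).ExactAt (n + 1) := by
  rw [HomologicalComplex.exactAt_iff' _ (n + 1 + 1) (n + 1) n (by simp) (by simp)]
  have h := ChainComplex.mkAux_eq_shortComplex_mk_d_comp_d X₀ X₁ X₂ d₁ d₂ w
    (fun S => ⟨Projective.syzygies S.f, Projective.d S.f, projective_d_comp S.f⟩) n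
  refine Eq.subst (motive := fun S : ShortComplex C => S.Exact) h ?_
  -- Exactness in degree 1 is the hypothesis; in higher degrees it holds because each new term
  -- covers the preceding kernel.
  match n with
  | 0 => exact hex
  | n + 1 => exact exact_d_f _

theorem resolutionComplex_projective {X₀ X₁ X₂ : C} [Projective X₀] [Projective X₁] [Projective X₂]
    (d₁ : X₁ ⟶ X₀) (d₂ : X₂ ⟶ X₁) (w : d₂ ≫ d₁ = 0) (n : ℕ) :
    Projective ((resolutionComplex d₁ d₂ w).X n) := by
  obtain (_ | _ | _ | n) := n
  · exact ‹Projective X₀›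
  · exact ‹Projective X₁›
  · exact ‹Projective X₂›
  · exact Projective.projective_over _

theorem exists_projectiveResolution {Z X₀ X₁ X₂ : C} [Projective X₀] [Projective X₁]
    [Projective X₂] (ε : X₀ ⟶ Z) (d₁ : X₁ ⟶ X₀) (d₂ : X₂ ⟶ X₁) (w₀ : d₁ ≫ ε = 0)
    (w₁ : d₂ ≫ d₁ = 0) (hε : Epi ε) (h₀ : (ShortComplex.mk d₁ ε w₀).Exact)
    (h₁ : (ShortComplex.mk d₂ d₁ w₁).Exact) :
    ∃ P : ProjectiveResolution Z,
      P.complex.X 0 = X₀ ∧ P.complex.X 1 = X₁ ∧ P.complex.X 2 = X₂ := by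
  have hd : (resolutionComplex d₁ d₂ w₁).d 1 0 = d₁ := ChainComplex.mk_d_1_0 ..
  refine ⟨{
    complex := resolutionComplex d₁ d₂ w₁
    projective := resolutionComplex_projective d₁ d₂ w₁
    π := (ChainComplex.toSingle₀Equiv _ _).symm ⟨ε, by rw [hd]; exact w₀⟩
    quasiIso := ⟨fun n => ?_⟩ }, rfl, rfl, rfl⟩
  cases n with
  | zero =>
    -- In degree 0 a quasi-isomorphism onto `Z` amounts to exactness of `X₁ ⟶ X₀ ⟶ Z ⟶ 0`.
    rw [ChainComplex.quasiIsoAt₀_iff, ShortComplex.quasiIso_iff_of_zeros']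
    · refine (ShortComplex.exact_and_epi_g_iff_of_iso (S₂ := ShortComplex.mk d₁ ε w₀) ?_).2
        ⟨h₀, hε⟩
      refine ShortComplex.isoMk (Iso.refl _) (Iso.refl _) (Iso.refl _) ?_ ?_
      · exact (Category.id_comp d₁).trans (hd.symm.trans (Category.comp_id _).symm)
      · refine (Category.id_comp ε).trans (Eq.trans ?_ (Category.comp_id _).symm)
        exact (ChainComplex.toSingle₀Equiv_symm_apply_f_zero (C := resolutionComplex d₁ d₂ w₁) ε
          (by rw [hd]; exact w₀)).symm
    all_goals rfl
  | succ n =>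
    rw [quasiIsoAt_iff_exactAt']
    · exact resolutionComplex_exactAt_succ d₁ d₂ w₁ h₁ n
    · exact ChainComplex.exactAt_succ_single_obj _ _

end Resolution

/-! ### The cellular resolution over the orbit category -/

section Cellular

open CategoryTheory Opposite

variable {G : Type u} [Group G] {F : Set (Subgroup G)}

/-- The inclusion `ℤ[T^K] → ℤ[T]`. -/
noncomputable def fixedIncl (T : Type u) [MulAction G T] (K : Subgroup G) :
    (FixedPts T K →₀ ℤ) →ₗ[ℤ] (T →₀ ℤ) :=
  Finsupp.lmapDomain ℤ ℤ Subtype.val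

section

variable {T : Type u} [MulAction G T] {K : Subgroup G}

theorem fixedIncl_single (t : FixedPts T K) (n : ℤ) :
    fixedIncl T K (Finsupp.single t n) = Finsupp.single t.1 n :=
  Finsupp.mapDomain_single

theorem fixedIncl_injective : Function.Injective (fixedIncl T K) :=
  Finsupp.mapDomain_injective Subtype.val_injective

theorem exists_fixedIncl_eq (x : T →₀ ℤ) (h : ∀ u ∈ x.support, ∀ k ∈ K, k • u = u) :
    ∃ y, fixedIncl T K y = x := by
  refine ⟨Finsupp.comapDomain Subtype.val x Subtype.val_injective.injOn, ?_⟩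
  refine Finsupp.mapDomain_comapDomain Subtype.val Subtype.val_injective x fun u hu => ?_
  exact ⟨(⟨u, h u hu⟩ : FixedPts T K), rfl⟩

theorem fixedIncl_map {A B : OrbitCat F} (φ : A ⟶ B) {g : G}
    (hg : OrbitCat.coset φ = QuotientGroup.mk g) (x : FixedPts T B.H →₀ ℤ) :
    fixedIncl T A.H (Finsupp.lmapDomain ℤ ℤ (fixedPtsMap T φ) x) =
      permRep T g (fixedIncl T B.H x) := by
  suffices h : fixedIncl T A.H ∘ₗ Finsupp.lmapDomain ℤ ℤ (fixedPtsMap T φ) =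
      permRep T g ∘ₗ fixedIncl T B.H from LinearMap.congr_fun h x
  refine Finsupp.lhom_ext' fun t => LinearMap.ext_ring ?_
  have h1 : (Finsupp.lmapDomain ℤ ℤ (fixedPtsMap T φ)) (Finsupp.single t 1) =
    Finsupp.single (fixedPtsMap T φ t) 1 := Finsupp.mapDomain_single
  simp only [LinearMap.comp_apply, Finsupp.lsingle_apply]
  rw [h1, fixedIncl_single, fixedIncl_single, permRep_single, fixedPtsMap_val φ hg]

end

/-- An equivariant map `ℤ[T] → ℤ[T']` that sends each point of `T` to a combination of points with
larger stabilizer. -/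
structure CellMap (T T' : Type u) [MulAction G T] [MulAction G T'] where
  toLin : (T →₀ ℤ) →ₗ[ℤ] (T' →₀ ℤ)
  equivariant : ∀ (g : G) x, toLin (permRep T g x) = permRep T' g (toLin x)
  fixed : ∀ (t : T) (u : T'), u ∈ (toLin (Finsupp.single t 1)).support →
    ∀ k : G, k • t = t → k • u = u

section

variable {T T' T'' : Type u} [MulAction G T] [MulAction G T'] [MulAction G T'']
  (d : CellMap (G := G) T T')

/-- The value of the induced morphism on a basis element. -/
noncomputable def CellMap.onFixed {K : Subgroup G} (t : FixedPts T K) : FixedPts T' K →₀ ℤ :=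
  (exists_fixedIncl_eq (K := K) (d.toLin (Finsupp.single t.1 1)) fun u hu k hk =>
    d.fixed t.1 u hu k (t.2 k hk)).choose

theorem CellMap.fixedIncl_onFixed {K : Subgroup G} (t : FixedPts T K) :
    fixedIncl T' K (d.onFixed t) = d.toLin (Finsupp.single t.1 1) :=
  (exists_fixedIncl_eq (K := K) (d.toLin (Finsupp.single t.1 1)) fun u hu k hk =>
    d.fixed t.1 u hu k (t.2 k hk)).choose_spec

variable (F)

/-- The morphism `ℤ[·, T] ⟶ ℤ[·, T']` of modules over the orbit category. -/
noncomputable def CellMap.orbitMap : inducedModule F T ⟶ inducedModule F T' :=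
  inducedDesc (M := inducedModule F T') (fun K t => d.onFixed (K := K.H) t) fun {L K} φ t => by
    obtain ⟨g, hg⟩ := QuotientGroup.mk_surjective (OrbitCat.coset φ)
    -- After embedding in `ℤ[T']`, naturality becomes equivariance under the representative `g`.
    refine fixedIncl_injective ((fixedIncl_map φ hg.symm (d.onFixed (K := K.H) t)).trans ?_)
    refine Eq.trans ?_ (d.fixedIncl_onFixed (K := L.H) (fixedPtsMap T φ t)).symm
    rw [d.fixedIncl_onFixed, ← d.equivariant, permRep_single, fixedPtsMap_val φ hg.symm]

/-- The value of the induced morphism at an object of the orbit category. -/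
noncomputable def CellMap.fixedLin (K : OrbitCat F) :
    (FixedPts T K.H →₀ ℤ) →ₗ[ℤ] (FixedPts T' K.H →₀ ℤ) :=
  ((d.orbitMap F).app (op K)).hom

/-- As the inclusions are injective, this reduces identities between orbit-category morphisms to
identities between ordinary linear maps. -/
theorem CellMap.fixedIncl_fixedLin (K : OrbitCat F) (x : FixedPts T K.H →₀ ℤ) :
    fixedIncl T' K.H (d.fixedLin F K x) = d.toLin (fixedIncl T K.H x) := by
  suffices h : fixedIncl T' K.H ∘ₗ d.fixedLin F K = d.toLin ∘ₗ fixedIncl T K.H from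
    LinearMap.congr_fun h x
  refine Finsupp.lhom_ext' fun t => LinearMap.ext_ring ?_
  have h1 : d.fixedLin F K (Finsupp.single t 1) = d.onFixed t :=
    inducedDesc_app_single (M := inducedModule F T') _ _ K t
  simp only [LinearMap.comp_apply, Finsupp.lsingle_apply]
  rw [h1, d.fixedIncl_onFixed, fixedIncl_single]

theorem CellMap.orbitMap_comp (d' : CellMap (G := G) T' T'')
    (h : ∀ x, d'.toLin (d.toLin x) = 0) : d.orbitMap F ≫ d'.orbitMap F = 0 := by
  refine NatTrans.ext (funext fun K => ModuleCat.hom_ext (LinearMap.ext fun x => ?_))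
  refine fixedIncl_injective (K := K.unop.H) ?_
  refine (d'.fixedIncl_fixedLin F K.unop (d.fixedLin F K.unop x)).trans ?_
  exact (congrArg d'.toLin (d.fixedIncl_fixedLin F K.unop x)).trans
    ((h _).trans (map_zero (fixedIncl T'' K.unop.H)).symm)

theorem CellMap.orbitMap_exact (d' : CellMap (G := G) T' T'')
    (h : ∀ x, d'.toLin (d.toLin x) = 0)
    (hex : ∀ (K : OrbitCat F) x, d'.fixedLin F K x = 0 → ∃ y, d.fixedLin F K y = x) :
    (ShortComplex.mk (d.orbitMap F) (d'.orbitMap F) (d.orbitMap_comp F d' h)).Exact := by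
  refine ShortComplex.exact_of_evaluation _ fun K => ?_
  rw [ShortComplex.moduleCat_exact_iff]
  exact hex K.unop

/-- Exactness at an object whose group fixes all points of `T`. -/
theorem CellMap.exists_fixedLin_eq {d : CellMap (G := G) T T'} {d' : CellMap (G := G) T' T''}
    (hex : ∀ x, d'.toLin x = 0 → ∃ y, d.toLin y = x) (K : OrbitCat F)
    (hK : K.H = ⊥) (x : FixedPts T' K.H →₀ ℤ)
    (hx : d'.fixedLin F K x = 0) : ∃ y, d.fixedLin F K y = x := by
  have h1 := d'.fixedIncl_fixedLin F K x
  rw [hx, map_zero] at h1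
  obtain ⟨y, hy⟩ := hex _ h1.symm
  obtain ⟨z, rfl⟩ := exists_fixedIncl_eq (K := K.H) y fun u _ k hk => by
    rw [hK, Subgroup.mem_bot] at hk
    rw [hk, one_smul]
  exact ⟨z, fixedIncl_injective ((d.fixedIncl_fixedLin F K z).trans hy)⟩

end

/-! ### The resolution from a relative presentation -/

section ConedOff

variable {𝓟 : Set (Subgroup G)} {σ : Type u} (f : σ → G)
  (R : Set (Monoid.Coprod (Monoid.CoprodI fun P : 𝓟 => P.1) (FreeGroup σ)))

theorem FreeCell.isEmpty_fixedPts {I : Type u} {K : Subgroup G} (hK : K ≠ ⊥) :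
    IsEmpty (FixedPts (FreeCell G I) K) :=
  ⟨fun t => hK ((Subgroup.eq_bot_iff_forall _).mpr fun k hk => eq_one_of_smul_eq (t.2 k hk))⟩

/-- The boundary map from edges to vertices. -/
noncomputable def edgeCellMap : CellMap (G := G) (FreeCell G (σ ⊕ 𝓟)) (ConedVertex 𝓟) where
  toLin := edgeBoundary f
  equivariant := edgeBoundary_permRep f
  fixed t u _ k hk := by rw [FreeCell.eq_one_of_smul_eq hk, one_smul]

/-- The boundary map from 2-cells to edges. -/
noncomputable def faceCellMap : CellMap (G := G) (FreeCell G R) (FreeCell G (σ ⊕ 𝓟)) where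
  toLin := cellBoundary f R
  equivariant := cellBoundary_permRep f R
  fixed t u _ k hk := by rw [FreeCell.eq_one_of_smul_eq hk, one_smul]

variable (𝓟) in
/-- The augmentation. -/
noncomputable def augCellMap : CellMap (G := G) (ConedVertex 𝓟) (G ⧸ (⊤ : Subgroup G)) where
  toLin := vertexAug
  equivariant := vertexAug_permRep
  fixed _ _ _ _ _ := QuotientGroup.subsingleton_quotient_top.elim _ _

/-- Every member of the family fixes some cone-vertex, and sending the generator of `ℤ` there is a
section at that object. -/
theorem epi_augCellMap : Epi ((augCellMap 𝓟).orbitMap (generatedFamily 𝓟)) := by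
  rw [orbitModule_epi_iff]
  rintro ⟨K, hK⟩ (y : FixedPts (G ⧸ (⊤ : Subgroup G)) K →₀ ℤ)
  obtain ⟨g, P, hP, hg⟩ := id hK
  let v : FixedPts (ConedVertex 𝓟) K :=
    ⟨.cone ⟨P, hP⟩ (QuotientGroup.mk g), fun k hk => ConedVertex.smul_cone_eq_iff.mpr (hg k hk)⟩
  let s : (FixedPts (G ⧸ (⊤ : Subgroup G)) K →₀ ℤ) →ₗ[ℤ] (FixedPts (ConedVertex 𝓟) K →₀ ℤ) :=
    Finsupp.lmapDomain ℤ ℤ fun _ => v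
  refine ⟨s y, fixedIncl_injective (((augCellMap 𝓟).fixedIncl_fixedLin _ ⟨K, hK⟩ (s y)).trans ?_)⟩
  suffices h : vertexAug ∘ₗ fixedIncl (ConedVertex 𝓟) K ∘ₗ s =
      fixedIncl (G ⧸ (⊤ : Subgroup G)) K from LinearMap.congr_fun h y
  refine Finsupp.lhom_ext' fun t => LinearMap.ext_ring ?_
  have h1 : s (Finsupp.single t 1) = Finsupp.single v 1 := Finsupp.mapDomain_single
  simp only [LinearMap.comp_apply, Finsupp.lsingle_apply]
  rw [h1, fixedIncl_single, fixedIncl_single, vertexAug_single]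
  congr 1
  exact QuotientGroup.subsingleton_quotient_top.elim _ _

theorem augCellMap_fixedLin_injective (hmal : IsMalnormalCollection 𝓟)
    (K : OrbitCat (generatedFamily 𝓟)) (hK : K.H ≠ ⊥) (x : FixedPts (ConedVertex 𝓟) K.H →₀ ℤ)
    (hx : (augCellMap 𝓟).fixedLin _ K x = 0) : x = 0 := by
  have h1 := (augCellMap 𝓟).fixedIncl_fixedLin _ K x
  rw [hx, map_zero] at h1
  obtain ⟨v, -, hv⟩ := ConedVertex.existsUnique_fixed hmal K.mem hK
  let c : FixedPts (ConedVertex 𝓟) K.H → G ⧸ (⊤ : Subgroup G) := fun _ => QuotientGroup.mk 1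
  -- A constant map is injective here because there is only one fixed vertex.
  have hc : Function.Injective c := fun a b _ =>
    Subtype.ext ((hv a.1 a.2).trans (hv b.1 b.2).symm)
  have h2 : Finsupp.mapDomain c x = 0 := by
    rw [h1]
    exact Finsupp.mapDomain_comp (f := Subtype.val)
      (g := fun _ : ConedVertex 𝓟 => (QuotientGroup.mk 1 : G ⧸ (⊤ : Subgroup G)))
  exact Finsupp.mapDomain_injective hc (h2.trans Finsupp.mapDomain_zero.symm)

theorem generatedFamily_conj (H : Subgroup G) (hH : H ∈ generatedFamily 𝓟) (g : G) :
    H.map (MulAut.conj g).toMonoidHom ∈ generatedFamily 𝓟 := by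
  obtain ⟨h, P, hP, hh⟩ := hH
  refine ⟨g * h, P, hP, ?_⟩
  rintro _ ⟨k, hk, rfl⟩
  have e : (g * h)⁻¹ * (g * k * g⁻¹) * (g * h) = h⁻¹ * k * h := by group
  change (g * h)⁻¹ * (g * k * g⁻¹) * (g * h) ∈ P
  rw [e]
  exact hh k hk

theorem orbitModuleFG_inducedModule {T : Type u} [MulAction G T]
    (hT : ∀ t : T, MulAction.stabilizer G t ∈ F)
    (hfin : Finite (MulAction.orbitRel.Quotient G T)) : OrbitModuleFG (inducedModule F T) :=
  ⟨T, inferInstance, hT, hfin, 𝟙 _, inferInstance⟩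

/-- A finite relative presentation gives a resolution that is finitely generated up to degree 2. -/
theorem isTypeFP_of_relativePresentation (hfin : 𝓟.Finite) (hmal : IsMalnormalCollection 𝓟)
    (hne : 𝓟.Nonempty) [Finite σ] (hR : R.Finite)
    (hsurj : Function.Surjective (coprodHom 𝓟 (FreeGroup.lift f)))
    (hker : Subgroup.normalClosure R = (coprodHom 𝓟 (FreeGroup.lift f)).ker) :
    IsTypeFP 2 (generatedFamily 𝓟) := by
  have := hfin.to_subtype
  have := hR.to_subtype
  have hfree : ∀ {I : Type u} (c : FreeCell G I), MulAction.stabilizer G c ∈ generatedFamily 𝓟 :=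
    fun c => by
      rw [c.stabilizer_eq_bot]
      exact bot_mem_generatedFamily hne
  have hvert : ∀ v : ConedVertex 𝓟, MulAction.stabilizer G v ∈ generatedFamily 𝓟 :=
    fun v => v.stabilizer_mem hne
  have := enoughProjectives_orbitModule (generatedFamily_conj (𝓟 := 𝓟))
  have := projective_inducedModule hvert
  have := projective_inducedModule (hfree (I := σ ⊕ 𝓟))
  have := projective_inducedModule (hfree (I := R))
  have hRone : ∀ r ∈ R, coprodHom 𝓟 (FreeGroup.lift f) r = 1 := fun r hr => by
    rw [← MonoidHom.mem_ker, ← hker]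
    exact Subgroup.subset_normalClosure hr
  have hcomp₀ : ∀ x, (augCellMap 𝓟).toLin ((edgeCellMap f).toLin x) = 0 := vertexAug_edgeBoundary f
  have hcomp₁ : ∀ x, (edgeCellMap f).toLin ((faceCellMap f R).toLin x) = 0 :=
    edgeBoundary_cellBoundary f hRone
  -- At the trivial subgroup this is the ordinary cellular complex; at any other object the
  -- augmentation is injective and the only cycle is zero.
  have hex₀ := (edgeCellMap f).orbitMap_exact (generatedFamily 𝓟) (augCellMap 𝓟) hcomp₀
    fun K x hx => by
      by_cases hK : K.H = ⊥
      · exact CellMap.exists_fixedLin_eq _ (exists_edgeBoundary_eq f hsurj) K hK x hx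
      · exact ⟨0, (map_zero _).trans (augCellMap_fixedLin_injective hmal K hK x hx).symm⟩
  have hex₁ := (faceCellMap f R).orbitMap_exact (generatedFamily 𝓟) (edgeCellMap f) hcomp₁
    fun K x hx => by
      by_cases hK : K.H = ⊥
      · exact CellMap.exists_fixedLin_eq _ (exists_cellBoundary_eq f hsurj hker) K hK x hx
      -- No edge is fixed, so the module of edges vanishes at this object.
      · have := FreeCell.isEmpty_fixedPts (I := σ ⊕ 𝓟) hK
        exact ⟨0, (map_zero _).trans (Subsingleton.elim _ _)⟩
  obtain ⟨P, h0, h1, h2⟩ := exists_projectiveResolution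
    (Z := trivialOrbitModule (generatedFamily 𝓟)) _ _ _ _ _
    epi_augCellMap hex₀ hex₁
  refine ⟨P, fun i hi => ?_⟩
  interval_cases i
  · rw [h0]
    exact orbitModuleFG_inducedModule hvert (ConedVertex.finite_orbits hfin)
  · rw [h1]
    exact orbitModuleFG_inducedModule hfree FreeCell.finite_orbits
  · rw [h2]
    exact orbitModuleFG_inducedModule hfree FreeCell.finite_orbits

/-- Over the empty family all modules vanish. -/
theorem isTypeFP_of_isEmpty (n : ℕ) (hF : F = ∅) : IsTypeFP n F := by
  subst hF
  have := enoughProjectives_orbitModule (G := G) (F := ∅) (fun H hH => hH.elim)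
  refine ⟨ProjectiveResolution.of _, fun i _ => ?_⟩
  exact ⟨FreeCell G PEmpty, inferInstance, fun c => c.idx.elim, FreeCell.finite_orbits, 0,
    (orbitModule_epi_iff _).mpr fun K => K.mem.elim⟩

theorem isTypeFP_of_isFinitelyPresented (hfin : 𝓟.Finite) (hmal : IsMalnormalCollection 𝓟)
    (hG : Group.IsFinitelyPresented G) (hfg : ∀ P ∈ 𝓟, P.FG) :
    IsTypeFP 2 (generatedFamily 𝓟) := by
  rcases 𝓟.eq_empty_or_nonempty with rfl | hne
  · exact isTypeFP_of_isEmpty 2 (Set.eq_empty_of_forall_notMem fun K ⟨_, _, hP, _⟩ => hP)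
  · obtain ⟨σ, _, f, R, hR, hsurj, hker⟩ := exists_relativePresentation hfin hG hfg
    exact isTypeFP_of_relativePresentation f R hfin hmal hne hR hsurj hker

end ConedOff

end Cellular

theorem proposition1p5 {G : Type u} [Group G] (𝓟 : Set (Subgroup G)) (hfin : 𝓟.Finite)
    (hmal : IsMalnormalCollection 𝓟) :
    (∀ pres : FiniteRelPresentation 𝓟,
      (𝓟.Nonempty → pres.conedOffCayleyComplex.IsF2Complex (generatedFamily 𝓟)) ∧
      (∀ d : pres.conedOffCayleyComplex.D, pres.conedOffCayleyComplex.edgeStabilizer d = ⊥) ∧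
      (∀ K ∈ generatedFamily 𝓟, (pres.conedOffCayleyComplex.fixed K).IsPoint ∨
        pres.conedOffCayleyComplex.FixesAll K)) ∧
    (Group.IsFinitelyPresented G → (∀ P ∈ 𝓟, P.FG) → IsTypeFP 2 (generatedFamily 𝓟)) :=
  ⟨fun pres => ⟨pres.isF2Complex hfin hmal, pres.edgeStabilizer_eq_bot,
    fun _ hK => pres.isPoint_or_fixesAll hmal hK⟩,
    isTypeFP_of_isFinitelyPresented hfin hmal⟩
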